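/- Let $p,q,n\ge 1$ be integers, let $\boldsymbol\theta$ be a real $p\times q$ matrix, and let $\boldsymbol\Sigma$ be a $p\times p$ symmetric positive definite matrix with symmetric positive definite square root $\boldsymbol A$. Let $\boldsymbol X$ ($p\times q$) and $\boldsymbol Y$ ($nq\times p$) be random matrices with $\boldsymbol X\sim\mathcal N_{p\times q}(\boldsymbol\theta,\boldsymbol\Sigma\otimes \boldsymbol I_q)$ and $\boldsymbol Y\sim\mathcal N_{nq\times p}(\boldsymbol 0,\boldsymbol I_{nq}\otimes(\boldsymbol\Sigma/q))$, that is, $\boldsymbol X$ and $\boldsymbol Y$ are Gaussian with $\mathrm E[\boldsymbol X]=\boldsymbol\theta$, $\mathrm{Cov}(X_{ij},X_{kl})=\Sigma_{ik}\delta_{jl}$, $\mathrm E[\boldsymbol Y]=\boldsymbol 0$, $\mathrm{Cov}(Y_{\alpha i},Y_{\beta k})=\delta_{\alpha\beta}\Sigma_{ik}/q$. Put $\boldsymbol S=\boldsymbol Y^\top\boldsymbol Y$ and suppose that $\boldsymbol X$ and $\boldsymbol S$ are independent. Let $\boldsymbol S^+$ be the Moore--Penrose inverse of $\boldsymbol S$,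 and let $$R=\mathrm{rank}(\boldsymbol S),\quad F=\mathrm{tr}(\boldsymbol X^\top\boldsymbol S^+\boldsymbol X),\quad \tilde{\boldsymbol Y}=\sqrt q\,\boldsymbol Y\boldsymbol A^{-1},\quad \boldsymbol G=\frac{r^2(F)}{F^2}\boldsymbol S^+\boldsymbol X\boldsymbol X^\top\boldsymbol S^+\boldsymbol S,\quad \boldsymbol H=\boldsymbol A\boldsymbol G\boldsymbol A^{-1},$$ where $r:\mathbb R\to[0,c_1]$ is differentiable with $|r'|\le c_2$, and $r(t)\in[c^*,c_1]$ for all $t\ge 0$, for some constants $c_1,c_2$ and $c^*>0$. Let $$D=\mathrm{div}_{\mathrm{vec}(\tilde{\boldsymbol Y})}\mathrm{vec}(\tilde{\boldsymbol Y}\boldsymbol H)=\sum_{\alpha,i}\frac{\partial(\tilde{\boldsymbol Y}\boldsymbol H)_{\alpha i}}{\partial\tilde Y_{\alpha i}},$$ where $\tilde{\boldsymbol Y}\boldsymbol H$ is regarded as a function of $\tilde{\boldsymbol Y}$ with $\boldsymbol X$ fixed (so $\boldsymbol Y=\tilde{\boldsymbol Y}\boldsymbol A/\sqrt q$). Suppose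 that $|p-nq|>1$. Then almost surely all the partial derivatives in $D$ exist, $D$ is measurable up to modification on a null set, and $$\mathrm E\,|D|<\infty\quad\text{if and only if}\quad \mathrm P(qR>2)=1.$$ -/

import Mathlib

open MeasureTheory ProbabilityTheory Matrix
open scoped Kronecker ENNReal

/-- `B` satisfies the four Penrose equations for the real matrix `A`, i.e. `B` is a
Moore-Penrose inverse of `A`. -/
structure IsMoorePenrose {m n : Type*} [Fintype m] [Fintype n]
    (A : Matrix m n ℝ) (B : Matrix n m ℝ) : Prop where
  mul_mul_self : A * B * A = A
  self_mul_mul : B * A * B = B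
  symm_left : (A * B)ᵀ = A * B
  symm_right : (B * A)ᵀ = B * A

theorem IsMoorePenrose.unique {m n : Type*} [Fintype m] [Fintype n]
    {A : Matrix m n ℝ} {B C : Matrix n m ℝ}
    (hB : IsMoorePenrose A B) (hC : IsMoorePenrose A C) : B = C := by
  have h1 : A * B = A * C := by
    calc A * B = (A * B)ᵀ := hB.symm_left.symm
      _ = ((A * C) * (A * B))ᵀ := by
          rw [← Matrix.mul_assoc, hC.mul_mul_self]
      _ = (A * B)ᵀ * (A * C)ᵀ := by rw [Matrix.transpose_mul]
      _ = A * B * A * C := by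
          rw [hB.symm_left, hC.symm_left]; simp only [Matrix.mul_assoc]
      _ = A * C := by rw [hB.mul_mul_self]
  have h2 : B * A = C * A := by
    calc B * A = (B * A)ᵀ := hB.symm_right.symm
      _ = ((B * A) * (C * A))ᵀ := by
          rw [Matrix.mul_assoc B A (C * A), ← Matrix.mul_assoc A C A, hC.mul_mul_self]
      _ = (C * A)ᵀ * (B * A)ᵀ := by rw [Matrix.transpose_mul]
      _ = C * (A * B * A) := by
          rw [hB.symm_right, hC.symm_right]; simp only [Matrix.mul_assoc]
      _ = C * A := by rw [hB.mul_mul_self]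
  calc B = B * A * B := hB.self_mul_mul.symm
    _ = C * (A * B) := by rw [h2, Matrix.mul_assoc]
    _ = C * A * C := by rw [h1, Matrix.mul_assoc]
    _ = C := hC.self_mul_mul

theorem IsMoorePenrose.transpose {m n : Type*} [Fintype m] [Fintype n]
    {A : Matrix m n ℝ} {B : Matrix n m ℝ} (h : IsMoorePenrose A B) :
    IsMoorePenrose Aᵀ Bᵀ := by
  refine ⟨?_, ?_, ?_, ?_⟩
  · rw [← Matrix.transpose_mul, ← Matrix.transpose_mul, ← Matrix.mul_assoc, h.mul_mul_self]
  · rw [← Matrix.transpose_mul, ← Matrix.transpose_mul, ← Matrix.mul_assoc, h.self_mul_mul]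
  · rw [← Matrix.transpose_mul, h.symm_right, h.symm_right]
  · rw [← Matrix.transpose_mul, h.symm_left, h.symm_left]

theorem exists_isMoorePenrose_of_isHermitian {n : Type*} [Fintype n] {H : Matrix n n ℝ}
    (hH : H.IsHermitian) : ∃ B, IsMoorePenrose H B := by
  classical
  let U : Matrix n n ℝ := (hH.eigenvectorUnitary : Matrix n n ℝ)
  let d := hH.eigenvalues
  have hU : Uᵀ * U = 1 := by
    have := Unitary.coe_star_mul_self hH.eigenvectorUnitary
    simpa [Matrix.star_eq_conjTranspose, Matrix.conjTranspose_eq_transpose_of_trivial] using this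
  have hs : H = U * diagonal d * Uᵀ := by
    have := hH.spectral_theorem
    simpa [Unitary.conjStarAlgAut_apply, Matrix.star_eq_conjTranspose,
      Matrix.conjTranspose_eq_transpose_of_trivial, Function.comp_def] using this
  have key : ∀ a b : n → ℝ, (U * diagonal a * Uᵀ) * (U * diagonal b * Uᵀ)
      = U * diagonal (fun i => a i * b i) * Uᵀ := by
    intro a b
    calc (U * diagonal a * Uᵀ) * (U * diagonal b * Uᵀ)
        = U * diagonal a * (Uᵀ * U) * diagonal b * Uᵀ := by simp only [Matrix.mul_assoc]
      _ = _ := by rw [hU, Matrix.mul_one, Matrix.mul_assoc U, diagonal_mul_diagonal]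
  have keyT : ∀ a : n → ℝ, (U * diagonal a * Uᵀ)ᵀ = U * diagonal a * Uᵀ := by
    intro a
    simp [Matrix.transpose_mul, Matrix.mul_assoc]
  refine ⟨U * diagonal (fun i => (d i)⁻¹) * Uᵀ, ?_, ?_, ?_, ?_⟩
  · rw [hs, key, key]
    congr 3
    funext i
    by_cases h : d i = 0 <;> simp [h]
  · rw [hs, key, key]
    congr 3
    funext i
    by_cases h : d i = 0 <;> simp [h]
  · rw [hs, key, keyT]
  · rw [hs, key, keyT]

theorem exists_isMoorePenrose {m n : Type*} [Fintype m] [Fintype n] (A : Matrix m n ℝ) :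
    ∃ B, IsMoorePenrose A B := by
  classical
  have hH : (Aᵀ * A).IsHermitian := by
    rw [Matrix.IsHermitian, Matrix.conjTranspose_eq_transpose_of_trivial, Matrix.transpose_mul,
      Matrix.transpose_transpose]
  have hHt : (Aᵀ * A)ᵀ = Aᵀ * A := by rw [Matrix.transpose_mul, Matrix.transpose_transpose]
  obtain ⟨K, hK⟩ := exists_isMoorePenrose_of_isHermitian hH
  have hKt : IsMoorePenrose (Aᵀ * A) Kᵀ := by
    have := hK.transpose
    rwa [hHt] at this
  have hKs : Kᵀ = K := hKt.unique hK
  have h0 : A * (K * (Aᵀ * A)) = A := by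
    have hz : (A * (K * (Aᵀ * A)) - A)ᴴ * (A * (K * (Aᵀ * A)) - A) = 0 := by
      have e : A * (K * (Aᵀ * A)) - A = A * (K * (Aᵀ * A) - 1) := by
        rw [Matrix.mul_sub, Matrix.mul_one]
      have z : Aᵀ * A * (K * (Aᵀ * A) - 1) = 0 := by
        rw [Matrix.mul_sub, Matrix.mul_one, ← Matrix.mul_assoc, hK.mul_mul_self, sub_self]
      rw [Matrix.conjTranspose_eq_transpose_of_trivial, e, Matrix.transpose_mul,
        Matrix.mul_assoc, ← Matrix.mul_assoc Aᵀ A, z, Matrix.mul_zero]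
    exact sub_eq_zero.mp (Matrix.conjTranspose_mul_self_eq_zero.mp hz)
  refine ⟨K * Aᵀ, ?_, ?_, ?_, ?_⟩
  · rw [Matrix.mul_assoc, Matrix.mul_assoc K, h0]
  · rw [Matrix.mul_assoc K Aᵀ A, ← Matrix.mul_assoc, hK.self_mul_mul]
  · rw [Matrix.transpose_mul, Matrix.transpose_mul, Matrix.transpose_transpose, hKs,
      Matrix.mul_assoc]
  · rw [Matrix.mul_assoc]
    exact hK.symm_right

/-- The Moore-Penrose inverse `A⁺` of a real matrix. -/
noncomputable def moorePenrose {m n : Type*} [Fintype m] [Fintype n] (A : Matrix m n ℝ) :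
    Matrix n m ℝ :=
  Classical.choose (exists_isMoorePenrose A)

theorem moorePenrose_spec {m n : Type*} [Fintype m] [Fintype n] (A : Matrix m n ℝ) :
    IsMoorePenrose A (moorePenrose A) :=
  Classical.choose_spec (exists_isMoorePenrose A)

open scoped MatrixOrder in
/-- The symmetric positive definite square root of a symmetric positive definite matrix. -/
noncomputable def matSqrt {p : ℕ} (Sig : Matrix (Fin p) (Fin p) ℝ) : Matrix (Fin p) (Fin p) ℝ :=
  CFC.sqrt Sig

open scoped MatrixOrder in
theorem matSqrt_mul_self {p : ℕ} {Sig : Matrix (Fin p) (Fin p) ℝ} (h : Sig.PosDef) :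
    matSqrt Sig * matSqrt Sig = Sig :=
  CFC.sqrt_mul_sqrt_self Sig h.posSemidef.nonneg

open scoped MatrixOrder in
theorem matSqrt_posDef {p : ℕ} {Sig : Matrix (Fin p) (Fin p) ℝ} (h : Sig.PosDef) :
    (matSqrt Sig).PosDef := by
  have hs : (matSqrt Sig).PosSemidef := (CFC.sqrt_nonneg Sig).posSemidef
  rw [hs.posDef_iff_det_ne_zero]
  intro h0
  have h1 := h.det_pos
  rw [← matSqrt_mul_self h, Matrix.det_mul, h0, mul_zero] at h1
  exact lt_irrefl _ h1

/-- The entries of a matrix as a vector, indexed by (row, column) pairs. -/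
noncomputable def vecEntries {m n : Type*} (M : Matrix m n ℝ) : EuclideanSpace ℝ (m × n) :=
  WithLp.toLp 2 (fun ij => M ij.1 ij.2)

/-- `U ∼ N(μ, A ⊗ B)`: the random matrix `U` is Gaussian with mean matrix `μ` and
`Cov (U i j, U k l) = A i k * B j l`. -/
def IsMatrixNormal {Ω : Type*} [MeasurableSpace Ω] {m n : Type*} [Fintype m] [Fintype n]
    [DecidableEq m] [DecidableEq n] (U : Ω → Matrix m n ℝ) (μ : Matrix m n ℝ)
    (A : Matrix m m ℝ) (B : Matrix n n ℝ) (P : Measure Ω) : Prop :=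
  HasLaw (fun ω => vecEntries (U ω)) (multivariateGaussian (vecEntries μ) (A ⊗ₖ B)) P

/-- `F = tr (Xᵀ S⁺ X)`. -/
noncomputable def statF {p q : ℕ} (X : Matrix (Fin p) (Fin q) ℝ)
    (S : Matrix (Fin p) (Fin p) ℝ) : ℝ :=
  (Xᵀ * moorePenrose S * X).trace

/-- `G = (r(F)² / F²) S⁺ X Xᵀ S⁺ S`. -/
noncomputable def matG {p q : ℕ} (r : ℝ → ℝ) (X : Matrix (Fin p) (Fin q) ℝ)
    (S : Matrix (Fin p) (Fin p) ℝ) : Matrix (Fin p) (Fin p) ℝ :=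
  (r (statF X S) ^ 2 / statF X S ^ 2) •
    (moorePenrose S * X * Xᵀ * moorePenrose S * S)

/-- `H = A G A⁻¹`, with `A` the positive definite square root of `Sig`. -/
noncomputable def matH {p q : ℕ} (r : ℝ → ℝ) (Sig : Matrix (Fin p) (Fin p) ℝ)
    (X : Matrix (Fin p) (Fin q) ℝ) (S : Matrix (Fin p) (Fin p) ℝ) :
    Matrix (Fin p) (Fin p) ℝ :=
  matSqrt Sig * matG r X S * (matSqrt Sig)⁻¹

/-- `Ỹ = √q Y A⁻¹`. -/
noncomputable def tildeY {p k : ℕ} (q : ℕ) (Sig : Matrix (Fin p) (Fin p) ℝ)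
    (Y : Matrix (Fin k) (Fin p) ℝ) : Matrix (Fin k) (Fin p) ℝ :=
  √(q : ℝ) • (Y * (matSqrt Sig)⁻¹)

/-- The matrix field `Ỹ ↦ Ỹ H`, as a function of the matrix variable `Ỹ = Z` for a fixed `X`;
here `H` is computed from `X` and `S = Yᵀ Y`, where `Y = Ỹ A / √q`. -/
noncomputable def fieldYH {p q k : ℕ} (r : ℝ → ℝ) (Sig : Matrix (Fin p) (Fin p) ℝ)
    (X : Matrix (Fin p) (Fin q) ℝ) (Z : Matrix (Fin k) (Fin p) ℝ) :
    Matrix (Fin k) (Fin p) ℝ :=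
  let Y := (√(q : ℝ))⁻¹ • (Z * matSqrt Sig)
  Z * matH r Sig X (Yᵀ * Y)

/-- The partial derivative `∂ Φ_{ij} / ∂ Z_{ij}` exists at `Z` for all `i`, `j`. -/
def HasPartials {k p : ℕ} (Φ : Matrix (Fin k) (Fin p) ℝ → Matrix (Fin k) (Fin p) ℝ)
    (Z : Matrix (Fin k) (Fin p) ℝ) : Prop :=
  ∀ i j, LineDifferentiableAt ℝ (fun W => Φ W i j) Z (Matrix.single i j 1)

/-- The divergence `div_{vec Z} vec (Φ Z) = ∑_{i,j} ∂ Φ_{ij} / ∂ Z_{ij}`. -/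
noncomputable def matDiv {k p : ℕ} (Φ : Matrix (Fin k) (Fin p) ℝ → Matrix (Fin k) (Fin p) ℝ)
    (Z : Matrix (Fin k) (Fin p) ℝ) : ℝ :=
  ∑ i, ∑ j, lineDeriv ℝ (fun W => Φ W i j) Z (Matrix.single i j 1)

/-! Write B = Y⁺, so that S⁺ = BBᵀ and Y G = φ(F) Bᵀ X Xᵀ B Y with φ(t) = r(t)²/t². Almost surely Y
has full rank, and near such a point Y⁺ is differentiable, with a derivative dictated by the Penrose
equations. Summing over the coordinate directions leaves only traces, A cancels by conjugation, and
with M = XᵀS⁺X and N = |p - nq| - 1 (`fieldYH_divergence_eq_divergenceValue`) D = N r(F)²/F - 2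
φ'(F) tr(M²). As 0 ≤ tr(M²) ≤ F², this is (N + 4x) r²/F - 4 r r' x with x in [0, 1]. Since N ≥ 1,
and r lies between positive bounds while r' is bounded, |D| is comparable to 1/F up to an additive
constant (`abs_divergenceValue_bounds`). The claim becomes: E[1/F] < ∞ iff qR > 2.

Now 1/F = ∫ exp(-tF) dt over t > 0. Given S, F is a quadratic form in the Gaussian X, and its
Laplace transform is a product over the eigenvalues d of A S⁺ A, each taken q times, of (1 +
2td)^(-1/2) times an exponential bounded above and below (`exists_laplace_quadraticForm`). Exactly R
eigenvalues are nonzero, so the decay is t^(-qR/2), integrable at infinity iff qR > 2. For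
finiteness after averaging over Y, the nonzero d are at least 1/(‖Y‖²‖A⁻¹‖²)
(`exists_spectral_conj_moorePenrose`), which bounds the conditional expectation by a multiple of
‖Y‖², and this has finite mean.

The rank R is almost surely the constant min(p, nq), so the probability on the right is 0 or 1.
Independence of X and S suffices because F and the closed form of D see Y only through S. -/

/-! ### Algebra of the Moore-Penrose inverse. -/

section MoorePenroseAlgebra

variable {m n : Type*} [Fintype m] [Fintype n]

theorem moorePenrose_eq_of_isMoorePenrose {A : Matrix m n ℝ} {B : Matrix n m ℝ}
    (h : IsMoorePenrose A B) : moorePenrose A = B :=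
  (moorePenrose_spec A).unique h

theorem moorePenrose_transpose (A : Matrix m n ℝ) : moorePenrose Aᵀ = (moorePenrose A)ᵀ :=
  moorePenrose_eq_of_isMoorePenrose (moorePenrose_spec A).transpose

/-- Both products of AᵀA with BBᵀ collapse to the projection BA. This turns every statement about S⁺
into one about Y⁺, which is easier to differentiate. -/
theorem IsMoorePenrose.transpose_mul_self {A : Matrix m n ℝ} {B : Matrix n m ℝ}
    (h : IsMoorePenrose A B) : IsMoorePenrose (Aᵀ * A) (B * Bᵀ) := by
  have hQ : Bᵀ * Aᵀ = A * B := by rw [← Matrix.transpose_mul, h.symm_left]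
  have hP : Aᵀ * Bᵀ = B * A := by rw [← Matrix.transpose_mul, h.symm_right]
  have e1 : Aᵀ * A * (B * Bᵀ) = B * A := by
    calc Aᵀ * A * (B * Bᵀ) = Aᵀ * (A * B) * Bᵀ := by simp only [Matrix.mul_assoc]
      _ = (Aᵀ * Bᵀ) * (Aᵀ * Bᵀ) := by rw [← hQ]; simp only [Matrix.mul_assoc]
      _ = (B * A * B) * A := by rw [hP]; simp only [Matrix.mul_assoc]
      _ = B * A := by rw [h.self_mul_mul]
  have e2 : B * Bᵀ * (Aᵀ * A) = B * A := by
    calc B * Bᵀ * (Aᵀ * A) = B * (Bᵀ * Aᵀ) * A := by simp only [Matrix.mul_assoc]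
      _ = (B * A * B) * A := by rw [hQ]; simp only [Matrix.mul_assoc]
      _ = B * A := by rw [h.self_mul_mul]
  refine ⟨?_, ?_, ?_, ?_⟩
  · rw [e1, ← hP]
    calc Aᵀ * Bᵀ * (Aᵀ * A) = Aᵀ * Bᵀ * Aᵀ * A := by simp only [Matrix.mul_assoc]
      _ = _ := by rw [h.transpose.mul_mul_self]
  · rw [e2, ← Matrix.mul_assoc, h.self_mul_mul]
  · rw [e1, h.symm_right]
  · rw [e2, h.symm_right]

theorem moorePenrose_transpose_mul_self (A : Matrix m n ℝ) :
    moorePenrose (Aᵀ * A) = moorePenrose A * (moorePenrose A)ᵀ :=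
  moorePenrose_eq_of_isMoorePenrose (moorePenrose_spec A).transpose_mul_self

theorem moorePenrose_eq_of_det_ne_zero [DecidableEq n] {A : Matrix m n ℝ}
    (h : (Aᵀ * A).det ≠ 0) : moorePenrose A = (Aᵀ * A)⁻¹ * Aᵀ := by
  have hu : IsUnit (Aᵀ * A).det := isUnit_iff_ne_zero.mpr h
  have e : (Aᵀ * A)⁻¹ * Aᵀ * A = 1 := by
    rw [Matrix.mul_assoc, Matrix.nonsing_inv_mul _ hu]
  refine moorePenrose_eq_of_isMoorePenrose ⟨?_, ?_, ?_, ?_⟩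
  · rw [Matrix.mul_assoc, e, Matrix.mul_one]
  · rw [e, Matrix.one_mul]
  · rw [Matrix.transpose_mul, Matrix.transpose_mul, Matrix.transpose_transpose,
      Matrix.transpose_nonsing_inv, Matrix.transpose_mul, Matrix.transpose_transpose,
      Matrix.mul_assoc]
  · rw [e, Matrix.transpose_one]

end MoorePenroseAlgebra

/-! ### Differentiating matrix curves and their Moore-Penrose inverses. -/

section MatrixDerivative

variable {l m n : Type*}

/-- `M'` is the entrywise derivative at `t` of the matrix valued function `M`. -/
def HasMatDerivAt (M : ℝ → Matrix m n ℝ) (M' : Matrix m n ℝ) (t : ℝ) : Prop :=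
  ∀ i j, HasDerivAt (fun s => M s i j) (M' i j) t

variable {M N : ℝ → Matrix m n ℝ} {M' N' : Matrix m n ℝ} {t : ℝ}

theorem HasMatDerivAt.unique (h : HasMatDerivAt M M' t) (h' : HasMatDerivAt M N' t) :
    M' = N' := by
  ext i j
  exact (h i j).unique (h' i j)

theorem hasMatDerivAt_const (C : Matrix m n ℝ) : HasMatDerivAt (fun _ => C) 0 t :=
  fun _ _ => hasDerivAt_const _ _

theorem HasMatDerivAt.transpose (h : HasMatDerivAt M M' t) :
    HasMatDerivAt (fun s => (M s)ᵀ) M'ᵀ t :=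
  fun i j => h j i

theorem HasMatDerivAt.congr_of_eventuallyEq (h : HasMatDerivAt M M' t)
    (hN : N =ᶠ[nhds t] M) : HasMatDerivAt N M' t := fun i j =>
  (h i j).congr_of_eventuallyEq (hN.mono fun _ hs => congrFun (congrFun hs i) j)

theorem HasMatDerivAt.smul {f : ℝ → ℝ} {f' : ℝ} (hf : HasDerivAt f f' t)
    (h : HasMatDerivAt M M' t) :
    HasMatDerivAt (fun s => f s • M s) (f' • M t + f t • M') t := fun i j => by
  simpa using hf.fun_mul (h i j)

theorem HasMatDerivAt.mul [Fintype n] {K : ℝ → Matrix n l ℝ} {K' : Matrix n l ℝ}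
    (h : HasMatDerivAt M M' t) (hK : HasMatDerivAt K K' t) :
    HasMatDerivAt (fun s => M s * K s) (M' * K t + M t * K') t := fun i j => by
  have := HasDerivAt.fun_sum (u := Finset.univ) fun k _ => (h i k).fun_mul (hK k j)
  simpa [Matrix.mul_apply, Finset.sum_add_distrib] using this

theorem HasMatDerivAt.mul_const [Fintype n] (h : HasMatDerivAt M M' t) (C : Matrix n l ℝ) :
    HasMatDerivAt (fun s => M s * C) (M' * C) t := by
  simpa using h.mul (hasMatDerivAt_const C)

theorem HasMatDerivAt.const_mul [Fintype m] (h : HasMatDerivAt M M' t) (C : Matrix l m ℝ) :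
    HasMatDerivAt (fun s => C * M s) (C * M') t := by
  simpa using (hasMatDerivAt_const C).mul h

theorem HasMatDerivAt.trace [Fintype m] {K : ℝ → Matrix m m ℝ} {K' : Matrix m m ℝ}
    (h : HasMatDerivAt K K' t) : HasDerivAt (fun s => (K s).trace) K'.trace t := by
  simpa [Matrix.trace] using HasDerivAt.fun_sum (u := Finset.univ) fun i _ => h i i

theorem hasMatDerivAt_line (Y E : Matrix m n ℝ) : HasMatDerivAt (fun s => Y + s • E) E t :=
  fun i j => by
    simpa using ((hasDerivAt_id t).mul_const (E i j)).const_add (Y i j)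

theorem differentiableAt_det [Fintype m] [DecidableEq m] {K : ℝ → Matrix m m ℝ}
    (h : ∀ i j, DifferentiableAt ℝ (fun s => K s i j) t) :
    DifferentiableAt ℝ (fun s => (K s).det) t := by
  simp only [Matrix.det_apply]
  refine DifferentiableAt.fun_sum fun σ _ => ?_
  refine DifferentiableAt.fun_const_smul ?_ _
  exact DifferentiableAt.fun_finsetProd fun i _ => h _ _

/-- Cramer's rule gives differentiability entry by entry. Only existence is needed, as the value of
the derivative of Y⁺ is recovered later from the Penrose equations. -/
theorem HasMatDerivAt.exists_inv [Fintype m] [DecidableEq m] {K : ℝ → Matrix m m ℝ}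
    {K' : Matrix m m ℝ} (h : HasMatDerivAt K K' t) (h0 : (K t).det ≠ 0) :
    ∃ C, HasMatDerivAt (fun s => (K s)⁻¹) C t := by
  have hd : ∀ i j, DifferentiableAt ℝ (fun s => (K s)⁻¹ i j) t := fun i j => by
    have e : (fun s => (K s)⁻¹ i j) =
        fun s => (K s).det⁻¹ * ((K s).updateRow j (Pi.single i 1)).det := by
      funext s
      rw [Matrix.inv_def, Ring.inverse_eq_inv', Matrix.smul_apply, smul_eq_mul,
        Matrix.adjugate_apply]
    rw [e]
    refine ((differentiableAt_det fun a b => (h a b).differentiableAt).fun_inv h0).fun_mul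
      (differentiableAt_det fun a b => ?_)
    by_cases ha : a = j
    · simp [Matrix.updateRow_apply, ha]
    · simpa [Matrix.updateRow_apply, ha] using (h a b).differentiableAt
  exact ⟨Matrix.of fun i j => deriv (fun s => (K s)⁻¹ i j) t, fun i j => (hd i j).hasDerivAt⟩

/-- Full column rank is an open condition, so Y⁺ = (YᵀY)⁻¹Yᵀ persists along the curve near t. -/
theorem HasMatDerivAt.exists_moorePenrose_of_det [Fintype m] [Fintype n] [DecidableEq n]
    (h : HasMatDerivAt M M' t) (h0 : ((M t)ᵀ * M t).det ≠ 0) :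
    ∃ C, HasMatDerivAt (fun s => moorePenrose (M s)) C t := by
  have hS := h.transpose.mul h
  obtain ⟨C, hC⟩ := hS.exists_inv h0
  have hev : ∀ᶠ s in nhds t, ((M s)ᵀ * M s).det ≠ 0 :=
    (differentiableAt_det fun a b => (hS a b).differentiableAt).continuousAt.eventually_ne h0
  exact ⟨_, (hC.mul h.transpose).congr_of_eventuallyEq
    (hev.mono fun s hs => moorePenrose_eq_of_det_ne_zero hs)⟩

theorem HasMatDerivAt.exists_moorePenrose [Fintype m] [Fintype n] [DecidableEq n] [DecidableEq m]
    (h : HasMatDerivAt M M' t) (h0 : ((M t)ᵀ * M t).det ≠ 0 ∨ (M t * (M t)ᵀ).det ≠ 0) :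
    ∃ C, HasMatDerivAt (fun s => moorePenrose (M s)) C t := by
  rcases h0 with h0 | h0
  · exact h.exists_moorePenrose_of_det h0
  · obtain ⟨C, hC⟩ := h.transpose.exists_moorePenrose_of_det
      (by rwa [Matrix.transpose_transpose])
    refine ⟨Cᵀ, ?_⟩
    simpa only [moorePenrose_transpose, Matrix.transpose_transpose] using hC.transpose

section MoorePenroseDerivative

variable [Fintype m] [Fintype n] [DecidableEq n]
  {Y E : Matrix m n ℝ} {B B' : Matrix n m ℝ}

/-- Differentiation of the equations `Y B Y = Y`, `B Y B = B`, `(Y B)ᵀ = Y B`, `(B Y)ᵀ = B Y`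
determines the derivative of the projection `B Y`. -/
theorem moorePenrose_projection_deriv (hB : IsMoorePenrose Y B) {P' : Matrix n n ℝ}
    (h1 : E * (B * Y) + Y * P' = E) (hs : P'ᵀ = P')
    (h2 : P' * (B * Y) + B * Y * P' = P') :
    P' = B * E * (1 - B * Y) + (1 - B * Y) * Eᵀ * Bᵀ := by
  -- Multiply `h1` by B on the left; the transpose gives the other half, and `h2` adds the two.
  have e1 : B * Y * P' = B * E * (1 - B * Y) := by
    have : B * (E * (B * Y) + Y * P') = B * E := by rw [h1]
    rw [Matrix.mul_add] at this
    rw [Matrix.mul_sub, Matrix.mul_one, eq_sub_iff_add_eq]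
    refine Eq.trans ?_ this
    simp only [Matrix.mul_assoc, add_comm]
  have e2 : P' * (B * Y) = (1 - B * Y) * Eᵀ * Bᵀ := by
    have := congrArg Matrix.transpose e1
    rw [Matrix.transpose_mul, hs, hB.symm_right, Matrix.transpose_mul, Matrix.transpose_mul,
      Matrix.transpose_sub, Matrix.transpose_one, hB.symm_right] at this
    rw [this, Matrix.mul_assoc]
  rw [← e1, ← e2, add_comm, h2]

/-- Differentiating B = (BY)B and B = B(YB) yields B' = BQ' + P'B - BEB, where P' and Q' are the
derivatives of the projections BY and YB. -/
theorem HasMatDerivAt.moorePenrose_eq [DecidableEq m] (h : HasMatDerivAt M E t)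
    (hB' : HasMatDerivAt (fun s => moorePenrose (M s)) B' t)
    (hY : M t = Y) (hB : moorePenrose (M t) = B) :
    B' * Y + B * E = B * E * (1 - B * Y) + (1 - B * Y) * Eᵀ * Bᵀ ∧
    B' = B * Bᵀ * Eᵀ * (1 - Y * B) + (1 - B * Y) * Eᵀ * Bᵀ * B - B * E * B := by
  have hBs : IsMoorePenrose Y B := by rw [← hY, ← hB]; exact moorePenrose_spec _
  have hP := hB'.mul h
  have hQ := h.mul hB'
  rw [hB, hY] at hP hQ
  set P' := B' * Y + B * E with hP'
  set Q' := E * B + Y * B' with hQ'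
  have hPf : P' = B * E * (1 - B * Y) + (1 - B * Y) * Eᵀ * Bᵀ := by
    refine moorePenrose_projection_deriv hBs ?_ ?_ ?_
    · have := h.mul hP
      rw [hB, hY] at this
      exact this.unique (by simpa only [← Matrix.mul_assoc, (moorePenrose_spec _).mul_mul_self] using h)
    · exact hP.transpose.unique (by simpa only [(moorePenrose_spec _).symm_right] using hP)
    · have := hP.mul hP
      rw [hB, hY] at this
      exact this.unique (by
        simpa only [← Matrix.mul_assoc, (moorePenrose_spec _).self_mul_mul] using hP)
  -- YB is the projection attached to Yᵀ, whose Moore-Penrose inverse is Bᵀ, so the same lemma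
  -- applies to the transposed data.
  have hQf : Q' = Bᵀ * Eᵀ * (1 - Y * B) + (1 - Y * B) * E * B := by
    have hT := hBs.transpose
    have hYB : Bᵀ * Yᵀ = Y * B := by rw [← Matrix.transpose_mul, hBs.symm_left]
    have := moorePenrose_projection_deriv hT (E := Eᵀ) (P' := Q') ?_ ?_ ?_
    · simpa only [hYB, Matrix.transpose_transpose] using this
    · rw [hYB]
      have := hQ.mul h
      rw [hB, hY] at this
      have h3 := this.unique (by simpa only [(moorePenrose_spec _).mul_mul_self] using h)
      have h4 := congrArg Matrix.transpose h3
      have hs : Q'ᵀ = Q' :=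
        hQ.transpose.unique (by simpa only [(moorePenrose_spec _).symm_left] using hQ)
      rw [Matrix.transpose_add, Matrix.transpose_mul, Matrix.transpose_mul, hs,
        hBs.symm_left] at h4
      rw [add_comm]; exact h4
    · exact hQ.transpose.unique (by simpa only [(moorePenrose_spec _).symm_left] using hQ)
    · rw [hYB]
      have := hQ.mul hQ
      rw [hB, hY] at this
      exact this.unique (by
        simpa only [← Matrix.mul_assoc, (moorePenrose_spec _).mul_mul_self] using hQ)
  refine ⟨hPf, ?_⟩
  have h5 : P' * B + B * Y * B' = B' := by
    have := hP.mul hB'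
    rw [hB, hY] at this
    exact this.unique (by simpa only [(moorePenrose_spec _).self_mul_mul] using hB')
  have h6 : B' * (Y * B) + B * Q' = B' := by
    have := hB'.mul hQ
    rw [hB, hY] at this
    exact this.unique (by
      simpa only [← Matrix.mul_assoc, (moorePenrose_spec _).self_mul_mul] using hB')
  have h7 : B' = B * Q' + P' * B - B * E * B := by
    have e : P' * B = B' * (Y * B) + B * E * B := by
      rw [hP', Matrix.add_mul, Matrix.mul_assoc B']
    rw [e]
    nth_rewrite 1 [← h6]
    abel
  have hBQ : B * (1 - Y * B) = 0 := by
    rw [Matrix.mul_sub, Matrix.mul_one, ← Matrix.mul_assoc, hBs.self_mul_mul, sub_self]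
  have hPB : (1 - B * Y) * B = 0 := by
    rw [Matrix.sub_mul, Matrix.one_mul, hBs.self_mul_mul, sub_self]
  rw [h7, hQf, hPf, Matrix.mul_add, Matrix.add_mul]
  have e1 : B * ((1 - Y * B) * E * B) = 0 := by
    rw [← Matrix.mul_assoc, ← Matrix.mul_assoc, hBQ]; simp
  have e2 : B * E * (1 - B * Y) * B = 0 := by rw [Matrix.mul_assoc, hPB]; simp
  rw [e1, e2, zero_add, add_zero]
  simp only [Matrix.mul_assoc]

end MoorePenroseDerivative

end MatrixDerivative

/-! ### Summing linear terms over the coordinate directions. -/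

section Divergence

variable {m n : Type*} [Fintype m] [Fintype n] [DecidableEq m] [DecidableEq n]

theorem sum_mul_single_mul_apply (L : Matrix m m ℝ) (R : Matrix n n ℝ) :
    ∑ i : m, ∑ j : n, (L * Matrix.single i j (1 : ℝ) * R) i j = L.trace * R.trace := by
  simp [Matrix.trace, Finset.sum_mul_sum, Matrix.mul_apply, Matrix.single_apply,
    ite_and]

theorem sum_mul_single_transpose_mul_apply (L R : Matrix m n ℝ) :
    ∑ i : m, ∑ j : n, (L * (Matrix.single i j (1 : ℝ))ᵀ * R) i j = (L * Rᵀ).trace := by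
  simp [Matrix.trace, Matrix.mul_apply, Matrix.single_apply,
    ite_and]

theorem sum_trace_mul_single_mul_apply (C : Matrix n m ℝ) (N : Matrix m n ℝ) :
    ∑ i : m, ∑ j : n, (C * Matrix.single i j (1 : ℝ)).trace * N i j = (C * N).trace := by
  simp [Matrix.trace, Matrix.mul_apply, Matrix.single_apply, ite_and]
  rw [Finset.sum_comm]

variable {A : Matrix n n ℝ} {c : ℝ}

/-- The direction E_ij in the variable Ỹ is c⁻¹ E_ij A in the variable Y, with c = √q. Conjugation
by A does not change the traces, so A and c drop out of the divergence. -/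
theorem sum_conj_single_apply (hA : IsUnit A.det) (hc : c ≠ 0) (L : Matrix m m ℝ)
    (R : Matrix n n ℝ) :
    ∑ i : m, ∑ j : n, c * (L * (c⁻¹ • (Matrix.single i j (1 : ℝ) * A)) * R * A⁻¹) i j
      = L.trace * R.trace := by
  have e : ∀ (i : m) (j : n), c * (L * (c⁻¹ • (Matrix.single i j (1 : ℝ) * A)) * R * A⁻¹) i j =
      (L * Matrix.single i j (1 : ℝ) * (A * R * A⁻¹)) i j := fun i j => by
    rw [Matrix.mul_smul, Matrix.smul_mul, Matrix.smul_mul, Matrix.smul_apply, smul_eq_mul,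
      mul_inv_cancel_left₀ hc]
    simp only [Matrix.mul_assoc]
  simp only [e]
  rw [sum_mul_single_mul_apply, Matrix.trace_mul_comm, ← Matrix.mul_assoc,
    Matrix.nonsing_inv_mul _ hA, Matrix.one_mul]

theorem sum_conj_single_transpose_apply (hA : IsUnit A.det) (hc : c ≠ 0) (L R : Matrix m n ℝ) :
    ∑ i : m, ∑ j : n, c * (L * (c⁻¹ • (Matrix.single i j (1 : ℝ) * A))ᵀ * R * A⁻¹) i j
      = (L * Rᵀ).trace := by
  have e : ∀ (i : m) (j : n), c * (L * (c⁻¹ • (Matrix.single i j (1 : ℝ) * A))ᵀ * R * A⁻¹) i j =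
      (L * Aᵀ * (Matrix.single i j (1 : ℝ))ᵀ * (R * A⁻¹)) i j := fun i j => by
    rw [Matrix.transpose_smul, Matrix.mul_smul, Matrix.smul_mul, Matrix.smul_mul,
      Matrix.smul_apply, smul_eq_mul, mul_inv_cancel_left₀ hc, Matrix.transpose_mul]
    simp only [Matrix.mul_assoc]
  simp only [e]
  rw [sum_mul_single_transpose_mul_apply, Matrix.transpose_mul, Matrix.mul_assoc,
    ← Matrix.mul_assoc Aᵀ, ← Matrix.transpose_mul, Matrix.nonsing_inv_mul _ hA,
    Matrix.transpose_one, Matrix.one_mul]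

theorem sum_trace_conj_single_apply (hA : IsUnit A.det) (hc : c ≠ 0) (C : Matrix n m ℝ)
    (N : Matrix m n ℝ) :
    ∑ i : m, ∑ j : n, c * ((C * (c⁻¹ • (Matrix.single i j (1 : ℝ) * A))).trace * (N * A⁻¹) i j)
      = (C * N).trace := by
  have e : ∀ (i : m) (j : n), c * ((C * (c⁻¹ • (Matrix.single i j (1 : ℝ) * A))).trace * (N * A⁻¹) i j) =
      ((A * C) * Matrix.single i j (1 : ℝ)).trace * (N * A⁻¹) i j := fun i j => by
    rw [Matrix.mul_smul, Matrix.trace_smul, smul_eq_mul, ← mul_assoc, mul_inv_cancel_left₀ hc,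
      ← Matrix.mul_assoc, Matrix.trace_mul_comm, Matrix.mul_assoc A]
  simp only [e]
  rw [sum_trace_mul_single_mul_apply, Matrix.mul_assoc, Matrix.trace_mul_comm,
    Matrix.mul_assoc, Matrix.mul_assoc, Matrix.nonsing_inv_mul _ hA, Matrix.mul_one]

theorem sum_conj_field_apply (hA : IsUnit A.det) (hc : c ≠ 0) (a b : ℝ) (C : Matrix n m ℝ)
    (N L₃ R₃ L₅ R₅ : Matrix m n ℝ) (L₁ L₂ L₄ : Matrix m m ℝ) (R₁ R₂ R₄ : Matrix n n ℝ) :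
    ∑ i : m, ∑ j : n, c * (((a * (2 * (C * (c⁻¹ • (Matrix.single i j (1 : ℝ) * A))).trace)) • N +
      b • (L₁ * (c⁻¹ • (Matrix.single i j (1 : ℝ) * A)) * R₁
        + L₂ * (c⁻¹ • (Matrix.single i j (1 : ℝ) * A)) * R₂
        - L₃ * (c⁻¹ • (Matrix.single i j (1 : ℝ) * A))ᵀ * R₃
        + L₄ * (c⁻¹ • (Matrix.single i j (1 : ℝ) * A)) * R₄
        + L₅ * (c⁻¹ • (Matrix.single i j (1 : ℝ) * A))ᵀ * R₅)) * A⁻¹) i j =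
    2 * a * (C * N).trace + b * (L₁.trace * R₁.trace + L₂.trace * R₂.trace - (L₃ * R₃ᵀ).trace
      + L₄.trace * R₄.trace + (L₅ * R₅ᵀ).trace) := by
  rw [← sum_conj_single_apply hA hc L₁, ← sum_conj_single_apply hA hc L₂,
    ← sum_conj_single_apply hA hc L₄, ← sum_conj_single_transpose_apply hA hc L₃,
    ← sum_conj_single_transpose_apply hA hc L₅, ← sum_trace_conj_single_apply hA hc]
  simp only [← Finset.sum_add_distrib, ← Finset.sum_sub_distrib, Finset.mul_sum]
  refine Finset.sum_congr rfl fun i _ => Finset.sum_congr rfl fun j _ => ?_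
  simp only [Matrix.add_mul _ _ A⁻¹, Matrix.sub_mul _ _ A⁻¹, Matrix.smul_mul _ _ A⁻¹,
    Matrix.add_apply, Matrix.smul_apply, Matrix.sub_apply, smul_eq_mul]
  ring

end Divergence

/-! ### Directional derivative of the shrinkage field. -/

section FieldDerivative

variable {l m n : Type*} [Fintype l] [Fintype m] [Fintype n] [DecidableEq m] [DecidableEq n]

/-- The derivative in direction `E` of `Y ↦ φ(F) (Y⁺)ᵀ X Xᵀ Y⁺ Y`, where `F = ‖(Y⁺)ᵀ X‖²`,
expressed through `B = Y⁺`, `T = X Xᵀ`, `P = Y⁺ Y`, `Q = Y Y⁺`. -/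
theorem hasMatDerivAt_shrinkageField (X : Matrix n l ℝ) (Y E : Matrix m n ℝ)
    (h0 : (Yᵀ * Y).det ≠ 0 ∨ (Y * Yᵀ).det ≠ 0) {φ : ℝ → ℝ} {φ' : ℝ}
    {B : Matrix n m ℝ} (hB : moorePenrose Y = B) {T P : Matrix n n ℝ} (hT : X * Xᵀ = T)
    (hP : B * Y = P)
    (hφ : HasDerivAt φ φ' (Xᵀ * (B * Bᵀ) * X).trace) :
    HasMatDerivAt (fun s : ℝ =>
        φ (Xᵀ * (moorePenrose (Y + s • E) * (moorePenrose (Y + s • E))ᵀ) * X).trace •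
        ((moorePenrose (Y + s • E))ᵀ * T * (moorePenrose (Y + s • E) * (Y + s • E))))
      ((φ' * (2 * (((1 - P) * T * B * Bᵀ * B - B * Bᵀ * T * B) * E).trace)) • (Bᵀ * T * P) +
        φ (Xᵀ * (B * Bᵀ) * X).trace •
          ((1 - Y * B) * E * (B * Bᵀ * T * P) + Bᵀ * B * E * ((1 - P) * T * P)
            - Bᵀ * Eᵀ * (Bᵀ * T * P) + Bᵀ * T * B * E * (1 - P)
            + Bᵀ * T * (1 - P) * Eᵀ * Bᵀ)) 0 := by
  have hBs : IsMoorePenrose Y B := hB ▸ moorePenrose_spec Y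
  have hl := hasMatDerivAt_line Y E (t := 0)
  have hl0 : Y + (0 : ℝ) • E = Y := by simp
  obtain ⟨B', hB'⟩ := hl.exists_moorePenrose (by rwa [hl0])
  obtain ⟨hPd, hBd⟩ := hl.moorePenrose_eq hB' hl0 (by rw [hl0, hB])
  rw [hP] at hPd hBd
  have hPt : Pᵀ = P := by rw [← hP, hBs.symm_right]
  have hQt : (Y * B)ᵀ = Y * B := hBs.symm_left
  have hTt : Tᵀ = T := by rw [← hT, Matrix.transpose_mul, Matrix.transpose_transpose]
  have hBQ : (1 - Y * B) * Bᵀ = 0 := by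
    have : B * (1 - Y * B) = 0 := by
      rw [Matrix.mul_sub, Matrix.mul_one, ← Matrix.mul_assoc, hBs.self_mul_mul, sub_self]
    have := congrArg Matrix.transpose this
    rwa [Matrix.transpose_mul, Matrix.transpose_sub, hQt, Matrix.transpose_one,
      Matrix.transpose_zero] at this
  have hF := (((hB'.mul hB'.transpose).const_mul Xᵀ).mul_const X).trace
  have hN := (hB'.transpose.mul_const T).mul (hB'.mul hl)
  simp only [hl0, hB] at hF hN
  rw [hPd] at hN
  have hφ' : HasDerivAt φ φ'
      (Xᵀ * (moorePenrose (Y + (0 : ℝ) • E) * (moorePenrose (Y + (0 : ℝ) • E))ᵀ) * X).trace := by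
    rw [hl0, hB]; exact hφ
  have hmain := HasMatDerivAt.smul (hφ'.comp (0 : ℝ) hF) hN
  have hFe : (Xᵀ * (B' * Bᵀ + B * B'ᵀ) * X).trace =
      2 * (((1 - P) * T * B * Bᵀ * B - B * Bᵀ * T * B) * E).trace := by
    have e1 : (Xᵀ * (B * B'ᵀ) * X).trace = (Xᵀ * (B' * Bᵀ) * X).trace := by
      rw [← Matrix.trace_transpose]
      simp only [Matrix.transpose_mul, Matrix.transpose_transpose, Matrix.mul_assoc]
    rw [Matrix.mul_add, Matrix.add_mul, Matrix.trace_add, e1, ← two_mul]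
    congr 1
    -- The term of B' ending in 1 - YB disappears because (1 - YB)Bᵀ = 0.
    have e2 : B' * Bᵀ = (1 - P) * Eᵀ * Bᵀ * B * Bᵀ - B * E * B * Bᵀ := by
      rw [hBd, Matrix.sub_mul, Matrix.add_mul, Matrix.mul_assoc _ (1 - Y * B), hBQ,
        Matrix.mul_zero, zero_add]
    have hX : ∀ K : Matrix n n ℝ, (Xᵀ * K * X).trace = (K * T).trace := fun K => by
      rw [Matrix.mul_assoc, Matrix.trace_mul_comm, Matrix.mul_assoc, hT]
    rw [hX, e2, Matrix.sub_mul, Matrix.trace_sub, Matrix.sub_mul (_ * _) _ E, Matrix.trace_sub]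
    congr 1
    · have e3 : (1 - P) * Eᵀ * Bᵀ * B * Bᵀ * T = (T * B * Bᵀ * B * E * (1 - P))ᵀ := by
        simp only [Matrix.transpose_mul, Matrix.transpose_transpose, Matrix.transpose_sub,
          Matrix.transpose_one, hPt, hTt, Matrix.mul_assoc]
      rw [e3, Matrix.trace_transpose, Matrix.trace_mul_comm]
      simp only [Matrix.mul_assoc]
    · rw [Matrix.mul_assoc (B * E), Matrix.mul_assoc (B * E), Matrix.trace_mul_comm]
      simp only [Matrix.mul_assoc]
  have hNe : B'ᵀ * T * P + Bᵀ * T * (B * E * (1 - P) + (1 - P) * Eᵀ * Bᵀ) =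
      (1 - Y * B) * E * (B * Bᵀ * T * P) + Bᵀ * B * E * ((1 - P) * T * P)
            - Bᵀ * Eᵀ * (Bᵀ * T * P) + Bᵀ * T * B * E * (1 - P)
            + Bᵀ * T * (1 - P) * Eᵀ * Bᵀ := by
    rw [hBd]
    simp only [Matrix.transpose_sub, Matrix.transpose_add, Matrix.transpose_mul,
      Matrix.transpose_transpose, Matrix.transpose_one, hPt]
    rw [show Bᵀ * Yᵀ = Y * B by rw [← Matrix.transpose_mul, hQt]]
    simp only [Matrix.sub_mul, Matrix.add_mul, Matrix.mul_add, Matrix.mul_assoc]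
    abel
  simp only [hP, hl0, hB, Function.comp_def] at hmain
  rw [hFe, hNe] at hmain
  exact hmain

end FieldDerivative

/-! ### Closed form of the divergence. -/

section FieldDivergence

variable {p q k : ℕ}

theorem statF_transpose_mul_self (X : Matrix (Fin p) (Fin q) ℝ) (Y : Matrix (Fin k) (Fin p) ℝ) :
    statF X (Yᵀ * Y) = (Xᵀ * (moorePenrose Y * (moorePenrose Y)ᵀ) * X).trace := by
  rw [statF, moorePenrose_transpose_mul_self]

theorem mul_matG_transpose_mul_self (r : ℝ → ℝ) (X : Matrix (Fin p) (Fin q) ℝ)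
    (Y : Matrix (Fin k) (Fin p) ℝ) :
    Y * matG r X (Yᵀ * Y) = (r (statF X (Yᵀ * Y)) ^ 2 / statF X (Yᵀ * Y) ^ 2) •
      ((moorePenrose Y)ᵀ * (X * Xᵀ) * (moorePenrose Y * Y)) := by
  have h := moorePenrose_spec Y
  set B := moorePenrose Y with hB
  have e1 : Y * (B * Bᵀ) = Bᵀ := by
    have := congrArg Matrix.transpose h.self_mul_mul
    rwa [Matrix.mul_assoc, Matrix.transpose_mul, h.symm_left, Matrix.mul_assoc] at this
  have e2 : B * Bᵀ * (Yᵀ * Y) = B * Y := by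
    rw [Matrix.mul_assoc, ← Matrix.mul_assoc Bᵀ, ← Matrix.transpose_mul, h.symm_left,
      ← Matrix.mul_assoc, ← Matrix.mul_assoc, h.self_mul_mul]
  rw [matG, moorePenrose_transpose_mul_self, Matrix.mul_smul, ← hB]
  congr 1
  calc Y * (B * Bᵀ * X * Xᵀ * (B * Bᵀ) * (Yᵀ * Y))
      = Y * (B * Bᵀ) * (X * Xᵀ) * (B * Bᵀ * (Yᵀ * Y)) := by simp only [Matrix.mul_assoc]
    _ = _ := by rw [e1, e2]

theorem fieldYH_eq (r : ℝ → ℝ) {Sig : Matrix (Fin p) (Fin p) ℝ} (hq : 1 ≤ q)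
    (X : Matrix (Fin p) (Fin q) ℝ) (Z : Matrix (Fin k) (Fin p) ℝ)
    {Y : Matrix (Fin k) (Fin p) ℝ} (hY : (√(q : ℝ))⁻¹ • (Z * matSqrt Sig) = Y) :
    fieldYH r Sig X Z = √(q : ℝ) • ((r (statF X (Yᵀ * Y)) ^ 2 / statF X (Yᵀ * Y) ^ 2) •
      ((moorePenrose Y)ᵀ * (X * Xᵀ) * (moorePenrose Y * Y)) * (matSqrt Sig)⁻¹) := by
  have hc : √(q : ℝ) ≠ 0 := by positivity
  have hZ : Z * matSqrt Sig = √(q : ℝ) • Y := by rw [← hY, smul_inv_smul₀ hc]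
  rw [fieldYH, hY, matH, ← mul_matG_transpose_mul_self, ← Matrix.mul_assoc, ← Matrix.mul_assoc, hZ,
    Matrix.smul_mul, Matrix.smul_mul]

/-- Each term of the directional derivative contributes a product of traces. Those with 1 - P next
to B or P vanish; the survivors give (k - tr P)F - F + (p - tr P)F times φ(F), and the derivative of
φ(F) contributes -2φ'(F) tr(M²). -/
theorem fieldYH_divergence {r : ℝ → ℝ} (hr : Differentiable ℝ r)
    {Sig : Matrix (Fin p) (Fin p) ℝ} (hSig : Sig.PosDef) (hq : 1 ≤ q)
    (X : Matrix (Fin p) (Fin q) ℝ) (Z : Matrix (Fin k) (Fin p) ℝ)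
    {Y : Matrix (Fin k) (Fin p) ℝ} (hY : (√(q : ℝ))⁻¹ • (Z * matSqrt Sig) = Y)
    (h0 : (Yᵀ * Y).det ≠ 0 ∨ (Y * Yᵀ).det ≠ 0) {F : ℝ} (hF : statF X (Yᵀ * Y) = F)
    (hF0 : F ≠ 0) {M : Matrix (Fin q) (Fin q) ℝ} (hM : Xᵀ * moorePenrose (Yᵀ * Y) * X = M) :
    HasPartials (fieldYH r Sig X) Z ∧
    matDiv (fieldYH r Sig X) Z =
      (k + p - 2 * (moorePenrose Y * Y).trace - 1) * (r F ^ 2 / F)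
        - 2 * (2 * r F * deriv r F / F ^ 2 - 2 * r F ^ 2 / F ^ 3) * (M * M).trace := by
  have hc : √(q : ℝ) ≠ 0 := by positivity
  have hA : IsUnit (matSqrt Sig).det := (matSqrt_posDef hSig).det_pos.ne'.isUnit
  set c := √(q : ℝ)
  set A := matSqrt Sig
  have hBs := moorePenrose_spec Y
  obtain ⟨B, hB⟩ : ∃ B, moorePenrose Y = B := ⟨_, rfl⟩
  obtain ⟨T, hT⟩ : ∃ T, X * Xᵀ = T := ⟨_, rfl⟩
  obtain ⟨P, hP⟩ : ∃ P, B * Y = P := ⟨_, rfl⟩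
  have hFB := hF
  rw [statF_transpose_mul_self, hB] at hFB
  have hφ : HasDerivAt (fun t => r t ^ 2 / t ^ 2)
      (2 * r F * deriv r F / F ^ 2 - 2 * r F ^ 2 / F ^ 3) F := by
    refine (((hr F).hasDerivAt.fun_pow 2).fun_div (hasDerivAt_pow 2 F)
      (pow_ne_zero 2 hF0)).congr_deriv ?_
    simp only [Nat.cast_ofNat, Nat.add_one_sub_one, pow_one]
    field_simp
  set φ : ℝ → ℝ := fun t => r t ^ 2 / t ^ 2 with hφdef
  set φ' : ℝ := 2 * r F * deriv r F / F ^ 2 - 2 * r F ^ 2 / F ^ 3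
  -- The value of the derivative is left to unification with the previous formula, since it is used
  -- only through the summation lemma.
  have key : ∀ (i : Fin k) (j : Fin p), HasDerivAt
      (fun s : ℝ => fieldYH r Sig X (Z + s • Matrix.single i j 1) i j) _ 0 := fun i j => by
    have h := ((hasMatDerivAt_shrinkageField X Y (c⁻¹ • (Matrix.single i j (1 : ℝ) * A)) h0 hB hT
      hP (by rw [hFB]; exact hφ)).mul_const A⁻¹ i j).const_mul c
    refine h.congr_of_eventuallyEq (Filter.Eventually.of_forall fun s => ?_)
    beta_reduce
    rw [fieldYH_eq r hq X _ (Y := Y + s • (c⁻¹ • (Matrix.single i j (1 : ℝ) * A))),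
      ← statF_transpose_mul_self, ← hT, Matrix.smul_apply, smul_eq_mul]
    rw [Matrix.add_mul, smul_add, hY, Matrix.smul_mul, smul_comm]
  refine ⟨fun i j => (key i j).differentiableAt, ?_⟩
  have hd : ∀ i j, lineDeriv ℝ (fun W => fieldYH r Sig X W i j) Z (Matrix.single i j 1) = _ :=
    fun i j => (key i j).deriv
  rw [matDiv]
  simp only [hd]
  rw [hB] at hBs ⊢
  have hPB : P * B = B := by rw [← hP, hBs.self_mul_mul]
  have hPt : Pᵀ = P := by rw [← hP, hBs.symm_right]
  have hTt : Tᵀ = T := by rw [← hT, Matrix.transpose_mul, Matrix.transpose_transpose]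
  have hP1 : (1 - P) * B = 0 := by rw [Matrix.sub_mul, Matrix.one_mul, hPB, sub_self]
  have hBP : Bᵀ * P = Bᵀ := by
    have := congrArg Matrix.transpose hPB
    rwa [Matrix.transpose_mul, hPt] at this
  have hPP : P * (1 - P) = 0 := by
    rw [Matrix.mul_sub, Matrix.mul_one, ← hP, ← Matrix.mul_assoc, hBs.self_mul_mul, sub_self]
  have hFT : (B * Bᵀ * T).trace = F := by
    rw [← hFB, ← hT, Matrix.mul_assoc Xᵀ, Matrix.trace_mul_comm Xᵀ]
    simp only [Matrix.mul_assoc]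
  have hMM : (M * M).trace = (B * Bᵀ * T * B * Bᵀ * T).trace := by
    have e1 : M * M = Xᵀ * (B * Bᵀ * X * (Xᵀ * (B * Bᵀ) * X)) := by
      rw [← hM, moorePenrose_transpose_mul_self, hB]
      simp only [Matrix.mul_assoc]
    rw [e1, Matrix.trace_mul_comm, ← hT]
    simp only [Matrix.mul_assoc]
  have hQ : (Y * B).trace = P.trace := by rw [← hP, Matrix.trace_mul_comm]
  rw [hFB]
  rw [sum_conj_field_apply hA hc]
  have t1 : (1 - Y * B).trace = k - P.trace := by simp [Matrix.trace_sub, hQ]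
  have t2 : (B * Bᵀ * T * P).trace = F := by
    rw [Matrix.trace_mul_comm, ← Matrix.mul_assoc, ← Matrix.mul_assoc, hPB, hFT]
  have t3 : ((1 - P) * T * P).trace = 0 := by
    rw [Matrix.trace_mul_comm, ← Matrix.mul_assoc, hPP, Matrix.zero_mul, Matrix.trace_zero]
  have t4 : (Bᵀ * (Bᵀ * T * P)ᵀ).trace = F := by
    rw [Matrix.transpose_mul, Matrix.transpose_mul, Matrix.transpose_transpose, hPt, hTt,
      ← Matrix.mul_assoc, hBP, ← Matrix.mul_assoc, Matrix.trace_mul_comm, ← Matrix.mul_assoc, hFT]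
  have t5 : (Bᵀ * T * B).trace = F := by
    rw [Matrix.trace_mul_comm, ← Matrix.mul_assoc, hFT]
  have t6 : (1 - P).trace = p - P.trace := by simp [Matrix.trace_sub]
  have t7 : (Bᵀ * T * (1 - P) * Bᵀᵀ).trace = 0 := by
    rw [Matrix.transpose_transpose, Matrix.mul_assoc, hP1, Matrix.mul_zero, Matrix.trace_zero]
  have t8 : (((1 - P) * T * B * Bᵀ * B - B * Bᵀ * T * B) * (Bᵀ * T * P)).trace =
      -(M * M).trace := by
    have u1 : ((1 - P) * T * B * Bᵀ * B * (Bᵀ * T * P)).trace = 0 := by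
      rw [← Matrix.mul_assoc, Matrix.trace_mul_comm]
      simp only [← Matrix.mul_assoc]
      rw [hPP]
      simp
    have u2 : (B * Bᵀ * T * B * (Bᵀ * T * P)).trace = (M * M).trace := by
      rw [← Matrix.mul_assoc, Matrix.trace_mul_comm]
      simp only [← Matrix.mul_assoc]
      rw [hPB, hMM]
    rw [Matrix.sub_mul, Matrix.trace_sub, u1, u2, zero_sub]
  have t9 : φ F * F = r F ^ 2 / F := by
    rw [hφdef]; field_simp
  rw [t1, t2, t3, t4, t5, t6, t7, t8, ← t9, hP]
  ring

end FieldDivergence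

/-! ### Comparing |D| with 1/F. -/

section Bounds

variable {l m n : Type*} [Fintype l] [Fintype m] [Fintype n]

theorem trace_moorePenrose_mul_self [DecidableEq n] {Y : Matrix m n ℝ}
    (h : (Yᵀ * Y).det ≠ 0) : (moorePenrose Y * Y).trace = Fintype.card n := by
  rw [moorePenrose_eq_of_det_ne_zero h, Matrix.mul_assoc,
    Matrix.nonsing_inv_mul _ (isUnit_iff_ne_zero.mpr h), Matrix.trace_one]

theorem trace_moorePenrose_mul_self' [DecidableEq m] {Y : Matrix m n ℝ}
    (h : (Y * Yᵀ).det ≠ 0) : (moorePenrose Y * Y).trace = Fintype.card m := by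
  have := trace_moorePenrose_mul_self (Y := Yᵀ) (by rwa [Matrix.transpose_transpose])
  rw [← this, moorePenrose_transpose, ← Matrix.transpose_mul, Matrix.trace_transpose,
    Matrix.trace_mul_comm]

theorem rank_transpose_mul_self_of_det_ne_zero [DecidableEq n] {Y : Matrix m n ℝ}
    (h : (Yᵀ * Y).det ≠ 0) : (Yᵀ * Y).rank = Fintype.card n :=
  Matrix.rank_of_isUnit _ ((Matrix.isUnit_iff_isUnit_det _).mpr (isUnit_iff_ne_zero.mpr h))

theorem rank_transpose_mul_self_of_det_ne_zero' [DecidableEq m] {Y : Matrix m n ℝ}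
    (h : (Y * Yᵀ).det ≠ 0) : (Yᵀ * Y).rank = Fintype.card m := by
  rw [Matrix.rank_transpose_mul_self, ← Matrix.rank_self_mul_transpose]
  exact Matrix.rank_of_isUnit _
    ((Matrix.isUnit_iff_isUnit_det _).mpr (isUnit_iff_ne_zero.mpr h))

theorem trace_transpose_mul_self_nonneg (N : Matrix m n ℝ) : 0 ≤ (Nᵀ * N).trace := by
  simp only [Matrix.trace, Matrix.diag_apply, Matrix.mul_apply, Matrix.transpose_apply]
  exact Finset.sum_nonneg fun i _ => Finset.sum_nonneg fun j _ => mul_self_nonneg _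

theorem trace_gram_sq_nonneg (N : Matrix m n ℝ) : 0 ≤ (Nᵀ * N * (Nᵀ * N)).trace := by
  have := trace_transpose_mul_self_nonneg (Nᵀ * N)
  rwa [Matrix.transpose_mul, Matrix.transpose_transpose] at this

/-- Cauchy-Schwarz for the columns bounds each squared Gram entry by a product of diagonal entries;
then sum. -/
theorem trace_gram_sq_le (N : Matrix m n ℝ) :
    (Nᵀ * N * (Nᵀ * N)).trace ≤ (Nᵀ * N).trace ^ 2 := by
  have hs : ∀ i j, (Nᵀ * N) i j * (Nᵀ * N) j i ≤ (Nᵀ * N) i i * (Nᵀ * N) j j := fun i j => by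
    have e : (Nᵀ * N) j i = (Nᵀ * N) i j := by
      simp only [Matrix.mul_apply, Matrix.transpose_apply, mul_comm]
    rw [e, ← sq]
    have := Finset.sum_mul_sq_le_sq_mul_sq Finset.univ (fun k => N k i) (fun k => N k j)
    simpa only [Matrix.mul_apply, Matrix.transpose_apply, ← sq] using this
  rw [sq, Matrix.trace, Matrix.trace, Finset.sum_mul_sum]
  refine Finset.sum_le_sum fun i _ => ?_
  rw [Matrix.diag_apply, Matrix.mul_apply]
  exact Finset.sum_le_sum fun j _ => hs i j

theorem statF_transpose_mul_self_eq_trace_gram {p q k : ℕ} (X : Matrix (Fin p) (Fin q) ℝ)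
    (Y : Matrix (Fin k) (Fin p) ℝ) :
    Xᵀ * moorePenrose (Yᵀ * Y) * X = ((moorePenrose Y)ᵀ * X)ᵀ * ((moorePenrose Y)ᵀ * X) := by
  rw [moorePenrose_transpose_mul_self, Matrix.transpose_mul, Matrix.transpose_transpose]
  simp only [Matrix.mul_assoc]

theorem statF_nonneg {p q k : ℕ} (X : Matrix (Fin p) (Fin q) ℝ)
    (Y : Matrix (Fin k) (Fin p) ℝ) : 0 ≤ statF X (Yᵀ * Y) := by
  rw [statF, statF_transpose_mul_self_eq_trace_gram]
  exact trace_transpose_mul_self_nonneg _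

/-- The closed form of the divergence of the shrinkage field, with `N = |p - nq| - 1`. -/
noncomputable def divergenceValue {p q : ℕ} (r : ℝ → ℝ) (N : ℝ) (X : Matrix (Fin p) (Fin q) ℝ)
    (S : Matrix (Fin p) (Fin p) ℝ) : ℝ :=
  N * (r (statF X S) ^ 2 / statF X S) -
    2 * (2 * r (statF X S) * deriv r (statF X S) / statF X S ^ 2
      - 2 * r (statF X S) ^ 2 / statF X S ^ 3) *
    (Xᵀ * moorePenrose S * X * (Xᵀ * moorePenrose S * X)).trace

/-- In full rank tr(Y⁺Y) = min(p, k), and k + p - 2 min(p, k) = |p - k|. -/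
theorem fieldYH_divergence_eq_divergenceValue {p q k : ℕ} {r : ℝ → ℝ} (hr : Differentiable ℝ r)
    {Sig : Matrix (Fin p) (Fin p) ℝ} (hSig : Sig.PosDef) (hq : 1 ≤ q)
    (X : Matrix (Fin p) (Fin q) ℝ) (Z : Matrix (Fin k) (Fin p) ℝ)
    {Y : Matrix (Fin k) (Fin p) ℝ} (hY : (√(q : ℝ))⁻¹ • (Z * matSqrt Sig) = Y)
    (h0 : (p ≤ k ∧ (Yᵀ * Y).det ≠ 0) ∨ (k ≤ p ∧ (Y * Yᵀ).det ≠ 0))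
    (hF0 : statF X (Yᵀ * Y) ≠ 0) :
    HasPartials (fieldYH r Sig X) Z ∧
    matDiv (fieldYH r Sig X) Z = divergenceValue r (|(p : ℝ) - k| - 1) X (Yᵀ * Y) := by
  obtain ⟨h1, h2⟩ := fieldYH_divergence hr hSig hq X Z hY (h0.imp (·.2) (·.2)) rfl hF0 rfl
  refine ⟨h1, ?_⟩
  rw [h2, divergenceValue]
  congr 2
  rcases h0 with ⟨hpk, h⟩ | ⟨hpk, h⟩
  · have : (p : ℝ) ≤ k := by exact_mod_cast hpk
    rw [trace_moorePenrose_mul_self h, abs_of_nonpos (by linarith), Fintype.card_fin]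
    ring
  · have : (k : ℝ) ≤ p := by exact_mod_cast hpk
    rw [trace_moorePenrose_mul_self' h, abs_of_nonneg (by linarith), Fintype.card_fin]
    ring

theorem abs_divergenceValue_bounds {p q k : ℕ} {r : ℝ → ℝ} {c₁ c₂ cstar N : ℝ}
    (hr_deriv : ∀ t, |deriv r t| ≤ c₂) (hcstar : 0 < cstar)
    (hr_low : ∀ t, 0 ≤ t → r t ∈ Set.Icc cstar c₁) (hN : 1 ≤ N)
    (X : Matrix (Fin p) (Fin q) ℝ) (Y : Matrix (Fin k) (Fin p) ℝ)
    (hF : 0 < statF X (Yᵀ * Y)) :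
    |divergenceValue r N X (Yᵀ * Y)| ≤ (N + 4) * c₁ ^ 2 * (statF X (Yᵀ * Y))⁻¹ + 4 * c₁ * c₂ ∧
    cstar ^ 2 * (statF X (Yᵀ * Y))⁻¹ ≤ |divergenceValue r N X (Yᵀ * Y)| + 4 * c₁ * c₂ := by
  have hm0 : 0 ≤ (Xᵀ * moorePenrose (Yᵀ * Y) * X * (Xᵀ * moorePenrose (Yᵀ * Y) * X)).trace := by
    rw [statF_transpose_mul_self_eq_trace_gram]
    exact trace_gram_sq_nonneg _
  have hm1 : (Xᵀ * moorePenrose (Yᵀ * Y) * X * (Xᵀ * moorePenrose (Yᵀ * Y) * X)).trace ≤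
      statF X (Yᵀ * Y) ^ 2 := by
    rw [statF, statF_transpose_mul_self_eq_trace_gram]
    exact trace_gram_sq_le _
  rw [divergenceValue]
  set F := statF X (Yᵀ * Y)
  set μ := (Xᵀ * moorePenrose (Yᵀ * Y) * X * (Xᵀ * moorePenrose (Yᵀ * Y) * X)).trace
  obtain ⟨hl, hu⟩ := hr_low F hF.le
  have hd := hr_deriv F
  set ρ := r F
  set δ := deriv r F
  have hc2 : 0 ≤ c₂ := (abs_nonneg _).trans hd
  have hρ0 : 0 ≤ ρ := hcstar.le.trans hl
  have hc1 : 0 ≤ c₁ := hρ0.trans hu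
  have hsq1 : ρ ^ 2 ≤ c₁ ^ 2 := by gcongr
  have hsq2 : cstar ^ 2 ≤ ρ ^ 2 := by gcongr
  -- In terms of this ratio, which lies in [0, 1], the r² part is nonnegative of order 1/F and the
  -- r' part is bounded.
  obtain ⟨x, hx⟩ : ∃ x, μ / F ^ 2 = x := ⟨_, rfl⟩
  have hx0 : 0 ≤ x := by rw [← hx]; positivity
  have hx1 : x ≤ 1 := by rw [← hx]; exact div_le_one_of_le₀ hm1 (by positivity)
  have e : N * (ρ ^ 2 / F) - 2 * (2 * ρ * δ / F ^ 2 - 2 * ρ ^ 2 / F ^ 3) * μ =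
      (N + 4 * x) * ρ ^ 2 * F⁻¹ - 4 * ρ * δ * x := by
    rw [← hx]; field_simp; ring
  rw [e]
  have hG : 0 < F⁻¹ := inv_pos.mpr hF
  have h1 : |4 * ρ * δ * x| ≤ 4 * c₁ * c₂ := by
    rw [abs_mul, abs_mul, abs_of_nonneg (by positivity : 0 ≤ 4 * ρ), abs_of_nonneg hx0]
    calc 4 * ρ * |δ| * x ≤ 4 * c₁ * c₂ * 1 := by gcongr
      _ = _ := mul_one _
  have h2 : cstar ^ 2 * F⁻¹ ≤ (N + 4 * x) * ρ ^ 2 * F⁻¹ := by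
    gcongr
    nlinarith [sq_nonneg ρ, mul_nonneg hx0 (sq_nonneg ρ)]
  have h3 : (N + 4 * x) * ρ ^ 2 * F⁻¹ ≤ (N + 4) * c₁ ^ 2 * F⁻¹ := by
    gcongr
    linarith
  have h4 : 0 ≤ (N + 4 * x) * ρ ^ 2 * F⁻¹ := by positivity
  constructor
  · refine (abs_sub _ _).trans ?_
    rw [abs_of_nonneg h4]
    exact add_le_add h3 h1
  · have := abs_sub_abs_le_abs_sub ((N + 4 * x) * ρ ^ 2 * F⁻¹) (4 * ρ * δ * x)
    rw [abs_of_nonneg h4] at this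
    linarith

end Bounds

/-! ### Measurability of S⁺, F and the closed form. -/

section Measurability

variable {p : ℕ}

theorem Matrix.IsHermitian.exists_orthogonal_diagonal {S : Matrix (Fin p) (Fin p) ℝ}
    (hS : S.IsHermitian) : ∃ (U : Matrix (Fin p) (Fin p) ℝ) (d : Fin p → ℝ),
      Uᵀ * U = 1 ∧ S = U * diagonal d * Uᵀ := by
  refine ⟨hS.eigenvectorUnitary, hS.eigenvalues, ?_, ?_⟩
  · have := Unitary.coe_star_mul_self hS.eigenvectorUnitary
    simpa [Matrix.star_eq_conjTranspose, Matrix.conjTranspose_eq_transpose_of_trivial] using this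
  · have := hS.spectral_theorem
    simpa [Unitary.conjStarAlgAut_apply, Matrix.star_eq_conjTranspose,
      Matrix.conjTranspose_eq_transpose_of_trivial, Function.comp_def] using this

/-- The Moore-Penrose inverse of a symmetric matrix is the limit of `(S² + ε)⁻¹ S`. -/
theorem tendsto_moorePenrose_of_isHermitian {S : Matrix (Fin p) (Fin p) ℝ} (hS : S.IsHermitian)
    (i j : Fin p) :
    Filter.Tendsto (fun N : ℕ => ((S * S + ((N : ℝ) + 1)⁻¹ • 1)⁻¹ * S) i j) Filter.atTop
      (nhds (moorePenrose S i j)) := by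
  obtain ⟨U, d, hU, hs⟩ := hS.exists_orthogonal_diagonal
  have hU' : U * Uᵀ = 1 := mul_eq_one_comm.mp hU
  have key : ∀ a b : Fin p → ℝ, (U * diagonal a * Uᵀ) * (U * diagonal b * Uᵀ)
      = U * diagonal (fun i => a i * b i) * Uᵀ := by
    intro a b
    calc (U * diagonal a * Uᵀ) * (U * diagonal b * Uᵀ)
        = U * diagonal a * (Uᵀ * U) * diagonal b * Uᵀ := by simp only [Matrix.mul_assoc]
      _ = _ := by rw [hU, Matrix.mul_one, Matrix.mul_assoc U, diagonal_mul_diagonal]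
  have keyT : ∀ a : Fin p → ℝ, (U * diagonal a * Uᵀ)ᵀ = U * diagonal a * Uᵀ := by
    intro a
    simp [Matrix.transpose_mul, Matrix.mul_assoc]
  have hMP : moorePenrose S = U * diagonal (fun i => (d i)⁻¹) * Uᵀ := by
    refine moorePenrose_eq_of_isMoorePenrose ⟨?_, ?_, ?_, ?_⟩
    · rw [hs, key, key]
      congr 3
      funext i
      by_cases h : d i = 0 <;> simp [h]
    · rw [hs, key, key]
      congr 3
      funext i
      by_cases h : d i = 0 <;> simp [h]
    · rw [hs, key, keyT]
    · rw [hs, key, keyT]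
  have hreg : ∀ ε : ℝ, 0 < ε →
      (S * S + ε • 1)⁻¹ * S = U * diagonal (fun i => d i / (d i * d i + ε)) * Uᵀ := by
    intro ε hε
    have hone : (1 : Matrix (Fin p) (Fin p) ℝ) = U * diagonal (fun _ => (1 : ℝ)) * Uᵀ := by
      rw [Matrix.diagonal_one, Matrix.mul_one, hU']
    have e1 : S * S + ε • 1 = U * diagonal (fun i => d i * d i + ε) * Uᵀ := by
      rw [hs, key, hone, ← Matrix.smul_mul, ← Matrix.mul_smul, ← Matrix.add_mul, ← Matrix.mul_add]
      congr 2
      ext a b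
      by_cases hab : a = b <;> simp [hab]
    have e2 : (S * S + ε • 1)⁻¹ = U * diagonal (fun i => (d i * d i + ε)⁻¹) * Uᵀ := by
      refine Matrix.inv_eq_right_inv ?_
      rw [e1, key, hone]
      congr 3
      funext i
      exact mul_inv_cancel₀ (by nlinarith [mul_self_nonneg (d i)])
    rw [e2]
    conv_lhs => rw [hs]
    rw [key]
    congr 3
    funext i
    rw [div_eq_mul_inv, mul_comm]
  have hlim : ∀ a : Fin p, Filter.Tendsto (fun N : ℕ => d a / (d a * d a + ((N : ℝ) + 1)⁻¹))
      Filter.atTop (nhds (d a)⁻¹) := by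
    intro a
    -- For a zero eigenvalue the quotient is constantly 0, which agrees with the convention `0⁻¹ =
    -- 0`.
    by_cases ha : d a = 0
    · simp [ha]
    · have : Filter.Tendsto (fun N : ℕ => ((N : ℝ) + 1)⁻¹) Filter.atTop (nhds 0) := by
        simpa using tendsto_one_div_add_atTop_nhds_zero_nat (𝕜 := ℝ)
      have h2 := (tendsto_const_nhds (x := d a)).div
        ((tendsto_const_nhds (x := d a * d a)).add this) (by simpa using ha)
      rwa [add_zero, div_mul_cancel_left₀ ha] at h2
  rw [hMP]
  have e : ∀ N : ℕ, ((S * S + ((N : ℝ) + 1)⁻¹ • 1)⁻¹ * S) i j =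
      ∑ a, U i a * (d a / (d a * d a + ((N : ℝ) + 1)⁻¹)) * U j a := fun N => by
    rw [hreg _ (by positivity)]
    simp [Matrix.mul_apply, Matrix.diagonal_apply]
  simp only [e]
  have e' : (U * diagonal (fun i => (d i)⁻¹) * Uᵀ) i j = ∑ a, U i a * (d a)⁻¹ * U j a := by
    simp [Matrix.mul_apply, Matrix.diagonal_apply]
  rw [e']
  exact tendsto_finsetSum _ fun a _ => ((hlim a).const_mul _).mul_const _

variable {α : Type*} [MeasurableSpace α] {l m n : Type*}

/-- All entries of the matrix valued function `M` are measurable. -/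
def MeasurableEntries (M : α → Matrix m n ℝ) : Prop := ∀ i j, Measurable fun a => M a i j

theorem measurableEntries_const (C : Matrix m n ℝ) : MeasurableEntries fun _ : α => C :=
  fun _ _ => measurable_const

theorem MeasurableEntries.mul [Fintype n] {M : α → Matrix m n ℝ} {N : α → Matrix n l ℝ}
    (hM : MeasurableEntries M) (hN : MeasurableEntries N) :
    MeasurableEntries fun a => M a * N a := fun i j => by
  simp only [Matrix.mul_apply]
  exact Finset.measurable_sum _ fun k _ => (hM i k).mul (hN k j)

theorem MeasurableEntries.add {M N : α → Matrix m n ℝ}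
    (hM : MeasurableEntries M) (hN : MeasurableEntries N) :
    MeasurableEntries fun a => M a + N a := fun i j => (hM i j).add (hN i j)

theorem MeasurableEntries.transpose {M : α → Matrix m n ℝ}
    (hM : MeasurableEntries M) : MeasurableEntries fun a => (M a)ᵀ := fun i j => hM j i

theorem MeasurableEntries.trace [Fintype m] {M : α → Matrix m m ℝ}
    (hM : MeasurableEntries M) : Measurable fun a => (M a).trace :=
  Finset.measurable_sum _ fun i _ => hM i i

theorem MeasurableEntries.det [Fintype m] [DecidableEq m] {M : α → Matrix m m ℝ}
    (hM : MeasurableEntries M) : Measurable fun a => (M a).det := by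
  simp only [Matrix.det_apply]
  exact Finset.measurable_sum _ fun σ _ =>
    (Finset.measurable_prod _ fun i _ => hM (σ i) i).const_smul _

theorem MeasurableEntries.inv [Fintype m] [DecidableEq m] {M : α → Matrix m m ℝ}
    (hM : MeasurableEntries M) : MeasurableEntries fun a => (M a)⁻¹ := fun i j => by
  simp only [Matrix.inv_def, Ring.inverse_eq_inv', Matrix.smul_apply, smul_eq_mul,
    Matrix.adjugate_apply]
  refine hM.det.inv.mul (MeasurableEntries.det fun a b => ?_)
  by_cases ha : a = j
  · simp [Matrix.updateRow_apply, ha]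
  · simpa [Matrix.updateRow_apply, ha] using hM a b

theorem MeasurableEntries.moorePenrose {S : α → Matrix (Fin p) (Fin p) ℝ}
    (hS : MeasurableEntries S) (hs : ∀ a, (S a).IsHermitian) :
    MeasurableEntries fun a => moorePenrose (S a) := fun i j =>
  measurable_of_tendsto_metrizable
    (f := fun (N : ℕ) a => ((S a * S a + ((N : ℝ) + 1)⁻¹ • 1)⁻¹ * S a) i j)
    (fun _ => (((hS.mul hS).add (measurableEntries_const _)).inv.mul hS) i j)
    (tendsto_pi_nhds.mpr fun a => tendsto_moorePenrose_of_isHermitian (hs a) i j)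

variable {q : ℕ} {X : α → Matrix (Fin p) (Fin q) ℝ} {S : α → Matrix (Fin p) (Fin p) ℝ}

theorem MeasurableEntries.statF (hX : MeasurableEntries X) (hS : MeasurableEntries S)
    (hs : ∀ a, (S a).IsHermitian) : Measurable fun a => statF (X a) (S a) :=
  ((hX.transpose.mul (hS.moorePenrose hs)).mul hX).trace

/-- Continuity of r' is not assumed; the derivative of a real function is Borel in any case. -/
theorem MeasurableEntries.divergenceValue (hX : MeasurableEntries X) (hS : MeasurableEntries S)
    (hs : ∀ a, (S a).IsHermitian) {r : ℝ → ℝ} (hr : Differentiable ℝ r) (N : ℝ) :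
    Measurable fun a => divergenceValue r N (X a) (S a) := by
  have hF := hX.statF hS hs
  have hM := (hX.transpose.mul (hS.moorePenrose hs)).mul hX
  have hrF := hr.continuous.measurable.comp hF
  have hdF := (measurable_deriv r).comp hF
  exact (((hrF.pow_const 2).div hF).const_mul N).sub
    ((((((hrF.const_mul 2).mul hdF).div (hF.pow_const 2)).sub
      (((hrF.pow_const 2).const_mul 2).div (hF.pow_const 3))).const_mul 2).mul (hM.mul hM).trace)

end Measurability

/-! ### Gaussian integrals, linear images and null sets. -/

section GaussianMeasure

open scoped NNReal RealInnerProductSpace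

variable {ι : Type*} [Fintype ι]

theorem gaussianReal_integral_exp_neg_sq {a : ℝ} (ha : 0 ≤ a) (η : ℝ) :
    ∫ y, Real.exp (-a * (y + η) ^ 2) ∂(gaussianReal 0 1) =
      (√(1 + 2 * a))⁻¹ * Real.exp (-a * η ^ 2 / (1 + 2 * a)) := by
  have hp : 0 < 1 + 2 * a := by linarith
  rw [integral_gaussianReal_eq_integral_smul one_ne_zero]
  -- Completing the square in a(y + η)² + y²/2.
  have e : ∀ y : ℝ, gaussianPDFReal 0 1 y • Real.exp (-a * (y + η) ^ 2) =
      ((√(2 * Real.pi))⁻¹ * Real.exp (-a * η ^ 2 / (1 + 2 * a))) *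
        Real.exp (-(a + 1 / 2) * (y + 2 * a * η / (1 + 2 * a)) ^ 2) := fun y => by
    rw [gaussianPDFReal, smul_eq_mul, NNReal.coe_one, mul_one, mul_assoc, mul_assoc, ← Real.exp_add,
      ← Real.exp_add]
    congr 2
    field_simp
    ring
  simp only [e]
  rw [integral_const_mul,
    integral_add_right_eq_self (fun y : ℝ => Real.exp (-(a + 1 / 2) * y ^ 2)), integral_gaussian,
    show Real.pi / (a + 1 / 2) = 2 * Real.pi / (1 + 2 * a) by field_simp; ring,
    Real.sqrt_div (by positivity)]
  have : √(2 * Real.pi) ≠ 0 := by positivity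
  field_simp

theorem pi_gaussianReal_lintegral_exp_neg_sum_sq {a : ι → ℝ} (ha : ∀ i, 0 ≤ a i) (η : ι → ℝ) :
    ∫⁻ y, ENNReal.ofReal (Real.exp (-∑ i, a i * (y i + η i) ^ 2))
      ∂(Measure.pi fun _ : ι => gaussianReal 0 1) =
      ENNReal.ofReal (∏ i, ((√(1 + 2 * a i))⁻¹ * Real.exp (-a i * η i ^ 2 / (1 + 2 * a i)))) := by
  have hint : Integrable (fun y : ι → ℝ => Real.exp (-∑ i, a i * (y i + η i) ^ 2))
      (Measure.pi fun _ : ι => gaussianReal 0 1) := by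
    refine Integrable.of_bound (Measurable.aestronglyMeasurable (by fun_prop)) 1
      (Filter.Eventually.of_forall fun y => ?_)
    rw [Real.norm_eq_abs, Real.abs_exp, Real.exp_le_one_iff, neg_nonpos]
    exact Finset.sum_nonneg fun i _ => mul_nonneg (ha i) (sq_nonneg _)
  rw [← ofReal_integral_eq_lintegral_ofReal hint
    (Filter.Eventually.of_forall fun y => (Real.exp_pos _).le)]
  congr 1
  have e : ∀ y : ι → ℝ, Real.exp (-∑ i, a i * (y i + η i) ^ 2) =
      ∏ i, Real.exp (-a i * (y i + η i) ^ 2) := fun y => by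
    rw [← Real.exp_sum, ← Finset.sum_neg_distrib]
    simp only [neg_mul]
  simp only [e]
  rw [integral_fintype_prod_eq_prod (f := fun i y => Real.exp (-a i * (y + η i) ^ 2))]
  exact Finset.prod_congr rfl fun i _ => gaussianReal_integral_exp_neg_sq (ha i) (η i)

/-- The characteristic function sees L only through ‖Lᵀt‖² = tᵀCt. An arbitrary factor L is allowed
so that an orthogonal matrix diagonalising a quadratic form can be absorbed into it. -/
theorem map_stdGaussian_eq_multivariateGaussian [DecidableEq ι] (μ : EuclideanSpace ℝ ι)
    {L C : Matrix ι ι ℝ} (hC : C.PosSemidef) (hL : L * Lᵀ = C) :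
    (stdGaussian (EuclideanSpace ℝ ι)).map (fun x => μ + toEuclideanCLM (𝕜 := ℝ) L x) =
      multivariateGaussian μ C := by
  refine Measure.ext_of_charFun ?_
  ext t
  have hcomp : (fun x => μ + toEuclideanCLM (𝕜 := ℝ) L x) =
      (fun x => μ + x) ∘ (toEuclideanCLM (𝕜 := ℝ) L) := rfl
  rw [charFun_multivariateGaussian hC, hcomp, ← Measure.map_map (by fun_prop) (by fun_prop),
    charFun_map_const_add]
  have h2 : charFun ((stdGaussian (EuclideanSpace ℝ ι)).map (toEuclideanCLM (𝕜 := ℝ) L)) t =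
      charFun (stdGaussian (EuclideanSpace ℝ ι))
        ((ContinuousLinearMap.adjoint (toEuclideanCLM (𝕜 := ℝ) L)) t) := by
    rw [charFun_apply, charFun_apply, integral_map (by fun_prop)
      (Measurable.aestronglyMeasurable (by fun_prop))]
    simp only [ContinuousLinearMap.adjoint_inner_right]
  have h3 : ‖(ContinuousLinearMap.adjoint (toEuclideanCLM (𝕜 := ℝ) L)) t‖ ^ 2 =
      t.ofLp ⬝ᵥ C *ᵥ t.ofLp := by
    rw [← real_inner_self_eq_norm_sq, ContinuousLinearMap.adjoint_inner_left,
      ← ContinuousLinearMap.star_eq_adjoint, ← map_star, Matrix.star_eq_conjTranspose,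
      Matrix.conjTranspose_eq_transpose_of_trivial, ← mul_apply_eq_comp, ← map_mul, hL,
      inner_toEuclideanCLM]
  rw [h2, charFun_stdGaussian, ← Complex.exp_add, ← Complex.ofReal_pow, h3, real_inner_comm]
  congr 1
  ring

theorem pi_absolutelyContinuous_fin {d : ℕ} {μ ν : Measure ℝ} [SigmaFinite μ] [SigmaFinite ν]
    (h : μ ≪ ν) :
    (Measure.pi fun _ : Fin d => μ) ≪ Measure.pi fun _ : Fin d => ν := by
  induction d with
  | zero => rw [Measure.pi_of_empty, Measure.pi_of_empty]
  | succ d ih =>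
    have h1 := measurePreserving_piFinSuccAbove (fun _ : Fin (d + 1) => μ) 0
    have h2 := measurePreserving_piFinSuccAbove (fun _ : Fin (d + 1) => ν) 0
    rw [← h1.symm.map_eq, ← h2.symm.map_eq]
    exact (h.prod ih).map (MeasurableEquiv.measurable _)

theorem pi_absolutelyContinuous {μ ν : Measure ℝ} [SigmaFinite μ] [SigmaFinite ν] (h : μ ≪ ν) :
    (Measure.pi fun _ : ι => μ) ≪ Measure.pi fun _ : ι => ν := by
  let e := (Fintype.equivFin ι).symm
  have h1 := measurePreserving_piCongrLeft (fun _ : ι => μ) e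
  have h2 := measurePreserving_piCongrLeft (fun _ : ι => ν) e
  rw [← h1.map_eq, ← h2.map_eq]
  exact (pi_absolutelyContinuous_fin h).map (MeasurableEquiv.measurable _)

theorem stdGaussian_absolutelyContinuous :
    stdGaussian (EuclideanSpace ℝ ι) ≪ volume := by
  rw [← map_pi_eq_stdGaussian, ← (PiLp.volume_preserving_toLp ι).map_eq]
  exact (pi_absolutelyContinuous
    (gaussianReal_absolutelyContinuous 0 one_ne_zero)).map (by fun_prop)

/-- A measurable set that meets every line of a fixed direction in a countable set is null. -/
theorem volume_eq_zero_of_countable_lines {N : Set (EuclideanSpace ℝ ι)} (hN : MeasurableSet N)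
    (v : EuclideanSpace ℝ ι) (h : ∀ x, {t : ℝ | x + t • v ∈ N}.Countable) : volume N = 0 := by
  have hm : Measurable fun z : EuclideanSpace ℝ ι × ℝ => z.1 + z.2 • v := by fun_prop
  have hs := hm hN
  -- Tonelli on pairs (x, t) with t in [0, 1]: slices at fixed x are countable, while slices at
  -- fixed t are translates of N.
  have h0 : ((volume : Measure (EuclideanSpace ℝ ι)).prod (volume.restrict (Set.Icc (0 : ℝ) 1)))
      ((fun z : EuclideanSpace ℝ ι × ℝ => z.1 + z.2 • v) ⁻¹' N) = 0 := by
    rw [Measure.measure_prod_null hs]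
    exact Filter.Eventually.of_forall fun x =>
      Measure.restrict_apply_eq_zero' measurableSet_Icc |>.mpr
        (measure_mono_null Set.inter_subset_left ((h x).measure_zero volume))
  rw [Measure.prod_apply_symm hs] at h0
  have e : ∀ t : ℝ, volume ((fun x => (x, t)) ⁻¹'
      ((fun z : EuclideanSpace ℝ ι × ℝ => z.1 + z.2 • v) ⁻¹' N)) = volume N := fun t =>
    measure_preimage_add_right volume (t • v) N
  simp only [e] at h0
  simpa using h0

open scoped MatrixOrder in
theorem multivariateGaussian_null_of_countable_lines [DecidableEq ι] {μ : EuclideanSpace ℝ ι}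
    {C : Matrix ι ι ℝ} (hC : C.PosDef)
    {N : Set (EuclideanSpace ℝ ι)} (hN : MeasurableSet N)
    (v : EuclideanSpace ℝ ι) (h : ∀ x, {t : ℝ | x + t • v ∈ N}.Countable) :
    multivariateGaussian μ C N = 0 := by
  have hLL : CFC.sqrt C * CFC.sqrt C = C := CFC.sqrt_mul_sqrt_self C hC.posSemidef.nonneg
  have hdet : IsUnit (CFC.sqrt C).det := by
    refine isUnit_iff_ne_zero.mpr fun h0 => hC.det_pos.ne' ?_
    rw [← hLL, Matrix.det_mul, h0, mul_zero]
  have hm : Measurable fun x => μ + toEuclideanCLM (𝕜 := ℝ) (CFC.sqrt C) x := by fun_prop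
  rw [multivariateGaussian, Measure.map_apply hm hN]
  -- Lines in direction C^(-1/2) v are carried to lines in direction v.
  refine stdGaussian_absolutelyContinuous (volume_eq_zero_of_countable_lines (hm hN)
    (toEuclideanCLM (𝕜 := ℝ) (CFC.sqrt C)⁻¹ v) fun x => ?_)
  have e : toEuclideanCLM (𝕜 := ℝ) (CFC.sqrt C) (toEuclideanCLM (𝕜 := ℝ) (CFC.sqrt C)⁻¹ v) = v := by
    rw [← mul_apply_eq_comp, ← map_mul, Matrix.mul_nonsing_inv _ hdet, map_one,
      one_apply_eq_self]
  have h2 := h (μ + toEuclideanCLM (𝕜 := ℝ) (CFC.sqrt C) x)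
  simpa only [Set.mem_preimage, map_add, map_smul, e, add_assoc] using h2

end GaussianMeasure

/-! ### Almost sure full rank and second moments of Gaussian matrices. -/

section RandomMatrix

variable {m n : Type*}

/-- The matrix with the given vector of entries. -/
def matOf (x : EuclideanSpace ℝ (m × n)) : Matrix m n ℝ := fun i j => x (i, j)

@[simp] theorem matOf_vecEntries (M : Matrix m n ℝ) : matOf (vecEntries M) = M := rfl

theorem measurableEntries_matOf [Fintype m] [Fintype n] :
    MeasurableEntries fun x : EuclideanSpace ℝ (m × n) => matOf x := fun i j => by
  unfold matOf
  fun_prop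

theorem countable_det_add_smul_one {d : ℕ} (M : Matrix (Fin d) (Fin d) ℝ) :
    {t : ℝ | (M + t • (1 : Matrix (Fin d) (Fin d) ℝ)).det = 0}.Countable := by
  have e : ∀ t : ℝ, (M + t • (1 : Matrix (Fin d) (Fin d) ℝ)).det = (-M).charpoly.eval t := by
    intro t
    rw [Matrix.eval_charpoly, sub_neg_eq_add, add_comm, Matrix.scalar_apply,
      Matrix.smul_one_eq_diagonal]
  simp only [e]
  exact (Polynomial.finite_setOfPred_isRoot (Matrix.charpoly_monic (-M)).ne_zero).countable

/-- A nonzero maximal minor makes Y injective, and YᵀY has the same kernel as Y. -/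
theorem det_transpose_mul_self_ne_zero [Fintype m] {d : ℕ} {Y : Matrix m (Fin d) ℝ} {f : Fin d → m}
    (h : (Y.submatrix f id).det ≠ 0) : (Yᵀ * Y).det ≠ 0 := by
  intro h0
  obtain ⟨v, hv, hv0⟩ := Matrix.exists_mulVec_eq_zero_iff.mpr h0
  have h1 : Y *ᵥ v = 0 := by
    have := Matrix.conjTranspose_mul_self_mulVec_eq_zero Y v
    rw [Matrix.conjTranspose_eq_transpose_of_trivial] at this
    exact this.mp hv0
  refine h (Matrix.exists_mulVec_eq_zero_iff.mp ⟨v, hv, ?_⟩)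
  ext i
  exact congrFun h1 (f i)

variable [Fintype m] [Fintype n] [DecidableEq m] [DecidableEq n]
  {μ : EuclideanSpace ℝ (m × n)} {C : Matrix (m × n) (m × n) ℝ}

theorem multivariateGaussian_ae_det_submatrix_ne_zero (hC : C.PosDef) {d : ℕ} {f : Fin d → m}
    {g : Fin d → n} (hf : Function.Injective f) (hg : Function.Injective g) :
    ∀ᵐ y ∂(multivariateGaussian μ C), ((matOf y).submatrix f g).det ≠ 0 := by
  have hm : Measurable fun y : EuclideanSpace ℝ (m × n) => ((matOf y).submatrix f g).det :=
    MeasurableEntries.det fun i j => measurableEntries_matOf (f i) (g j)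
  -- Moving along V adds t times the identity to the chosen minor, whose determinant is then a
  -- characteristic polynomial in t with finitely many roots.
  let V : Matrix m n ℝ := Matrix.of fun i j => ∑ k, if f k = i ∧ g k = j then 1 else 0
  have hV : V.submatrix f g = 1 := by
    ext a b
    simp only [Matrix.submatrix_apply, V, Matrix.of_apply, hf.eq_iff, hg.eq_iff, Matrix.one_apply]
    simp [ite_and]
  refine (ae_iff.mpr ?_)
  simp only [ne_eq, not_not]
  refine multivariateGaussian_null_of_countable_lines hC (hm (measurableSet_singleton 0))
    (vecEntries V) fun x => ?_
  convert countable_det_add_smul_one ((matOf x).submatrix f g) using 4 with t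
  rw [← hV]
  rfl

theorem multivariateGaussian_ae_full_rank {k p : ℕ} {μ : EuclideanSpace ℝ (Fin k × Fin p)}
    {C : Matrix (Fin k × Fin p) (Fin k × Fin p) ℝ} (hC : C.PosDef) :
    ∀ᵐ y ∂(multivariateGaussian μ C), (p ≤ k ∧ ((matOf y)ᵀ * matOf y).det ≠ 0) ∨
      (k ≤ p ∧ (matOf y * (matOf y)ᵀ).det ≠ 0) := by
  rcases le_total p k with h | h
  · filter_upwards [multivariateGaussian_ae_det_submatrix_ne_zero (μ := μ) hC
      (Fin.castLE_injective h) Function.injective_id] with y hy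
    exact Or.inl ⟨h, det_transpose_mul_self_ne_zero hy⟩
  · filter_upwards [multivariateGaussian_ae_det_submatrix_ne_zero (μ := μ) hC
      Function.injective_id (Fin.castLE_injective h)] with y hy
    refine Or.inr ⟨h, ?_⟩
    have := det_transpose_mul_self_ne_zero (Y := (matOf y)ᵀ) (f := Fin.castLE h) (by
      rw [← Matrix.det_transpose] at hy
      exact hy)
    rwa [Matrix.transpose_transpose] at this

theorem multivariateGaussian_lintegral_sum_sq_lt_top (hC : C.PosSemidef) :
    ∫⁻ y, ENNReal.ofReal (∑ i, ∑ j, matOf y i j ^ 2) ∂(multivariateGaussian μ C) < ∞ := by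
  have hint : Integrable (fun y => ∑ i, ∑ j, matOf y i j ^ 2) (multivariateGaussian μ C) := by
    refine integrable_finsetSum _ fun i _ => integrable_finsetSum _ fun j _ => ?_
    have h := measurePreserving_eval_multivariateGaussian (μ := μ) hC (i := (i, j))
    have h2 : MemLp id 2 (gaussianReal (μ (i, j)) (C (i, j) (i, j)).toNNReal) :=
      IsGaussian.memLp_two_id
    exact (h2.comp_measurePreserving h).integrable_sq
  exact (hasFiniteIntegral_iff_ofReal (Filter.Eventually.of_forall fun y =>
    Finset.sum_nonneg fun i _ => Finset.sum_nonneg fun j _ => sq_nonneg _)).mp hint.2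

end RandomMatrix

/-! ### Laplace transform of the quadratic form in X. -/

section QuadraticForm

variable {p q : ℕ}

theorem trace_transpose_mul_diagonal_mul (V : Matrix (Fin p) (Fin q) ℝ) (d : Fin p → ℝ) :
    (Vᵀ * diagonal d * V).trace = ∑ i : Fin p × Fin q, d i.1 * V i.1 i.2 ^ 2 := by
  rw [Fintype.sum_prod_type_right, Matrix.trace]
  refine Finset.sum_congr rfl fun l _ => ?_
  rw [Matrix.diag_apply, Matrix.mul_apply]
  refine Finset.sum_congr rfl fun k _ => ?_
  rw [Matrix.mul_diagonal, Matrix.transpose_apply]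
  ring

/-- In law X = A U (W + η) with W standard and η = Uᵀ A⁻¹ θ, so the form becomes the sum of d_i
(W_il + η_il)² over independent coordinates. The shift η does not depend on t. -/
theorem exists_laplace_quadraticForm {Sig : Matrix (Fin p) (Fin p) ℝ} (hSig : Sig.PosDef)
    (θ : Matrix (Fin p) (Fin q) ℝ) {K U : Matrix (Fin p) (Fin p) ℝ} {d : Fin p → ℝ}
    (hU : Uᵀ * U = 1) (hK : matSqrt Sig * K * matSqrt Sig = U * diagonal d * Uᵀ)
    (hd : ∀ i, 0 ≤ d i) :
    ∃ η : Fin p × Fin q → ℝ, ∀ t : ℝ, 0 ≤ t →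
      ∫⁻ x, ENNReal.ofReal (Real.exp (-(t * ((matOf x)ᵀ * K * matOf x).trace)))
        ∂(multivariateGaussian (vecEntries θ) (Sig ⊗ₖ (1 : Matrix (Fin q) (Fin q) ℝ))) =
      ENNReal.ofReal (∏ i : Fin p × Fin q, ((√(1 + 2 * (t * d i.1)))⁻¹ *
        Real.exp (-(t * d i.1) * η i ^ 2 / (1 + 2 * (t * d i.1))))) := by
  have hApd := matSqrt_posDef hSig
  have hAA := matSqrt_mul_self hSig
  obtain ⟨A, hA⟩ : ∃ A, matSqrt Sig = A := ⟨_, rfl⟩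
  rw [hA] at hApd hAA hK
  have hAt : Aᵀ = A := by
    rw [← Matrix.conjTranspose_eq_transpose_of_trivial]; exact hApd.isHermitian
  have hAd : IsUnit A.det := hApd.det_pos.ne'.isUnit
  have hU' : U * Uᵀ = 1 := mul_eq_one_comm.mp hU
  have hL : ((A * U) ⊗ₖ (1 : Matrix (Fin q) (Fin q) ℝ)) *
      ((A * U) ⊗ₖ (1 : Matrix (Fin q) (Fin q) ℝ))ᵀ = Sig ⊗ₖ (1 : Matrix (Fin q) (Fin q) ℝ) := by
    rw [← Matrix.kroneckerMap_transpose, ← Matrix.mul_kronecker_mul, Matrix.transpose_one,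
      Matrix.mul_one, Matrix.transpose_mul, hAt, Matrix.mul_assoc, ← Matrix.mul_assoc U, hU',
      Matrix.one_mul, hAA]
  let η : Matrix (Fin p) (Fin q) ℝ := Uᵀ * A⁻¹ * θ
  have hη : θ = A * U * η := by
    simp only [η]
    rw [Matrix.mul_assoc Uᵀ, ← Matrix.mul_assoc, Matrix.mul_assoc A, hU', Matrix.mul_one,
      Matrix.mul_nonsing_inv_cancel_left _ _ hAd]
  refine ⟨fun i => η i.1 i.2, fun t ht => ?_⟩
  have hmK : Measurable fun x : EuclideanSpace ℝ (Fin p × Fin q) =>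
      ((matOf x)ᵀ * K * matOf x).trace :=
    ((measurableEntries_matOf.transpose.mul (measurableEntries_const K)).mul
      measurableEntries_matOf).trace
  have hmf : Measurable fun x : EuclideanSpace ℝ (Fin p × Fin q) =>
      ENNReal.ofReal (Real.exp (-(t * ((matOf x)ᵀ * K * matOf x).trace))) := by fun_prop
  have hmf' := hmf.comp (f := fun x : EuclideanSpace ℝ (Fin p × Fin q) =>
    vecEntries θ + toEuclideanCLM (𝕜 := ℝ) ((A * U) ⊗ₖ (1 : Matrix (Fin q) (Fin q) ℝ)) x)
    (by fun_prop)
  rw [Function.comp_def] at hmf'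
  have hSp : (Sig ⊗ₖ (1 : Matrix (Fin q) (Fin q) ℝ)).PosSemidef :=
    (hSig.kronecker Matrix.PosDef.one).posSemidef
  rw [← map_stdGaussian_eq_multivariateGaussian _ hSp hL, lintegral_map hmf (by fun_prop),
    ← map_pi_eq_stdGaussian, lintegral_map hmf' (by fun_prop)]
  refine Eq.trans ?_ (pi_gaussianReal_lintegral_exp_neg_sum_sq
    (a := fun i : Fin p × Fin q => t * d i.1) (fun i => mul_nonneg ht (hd i.1))
    (fun i => η i.1 i.2))
  refine lintegral_congr fun y => ?_
  congr 3
  let W : Matrix (Fin p) (Fin q) ℝ := Matrix.of fun i j => y (i, j)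
  have e1 : matOf (vecEntries θ + toEuclideanCLM (𝕜 := ℝ)
      ((A * U) ⊗ₖ (1 : Matrix (Fin q) (Fin q) ℝ)) (WithLp.toLp 2 y)) = A * U * (W + η) := by
    rw [Matrix.mul_add, ← hη, add_comm]
    ext i j
    simp only [matOf, PiLp.add_apply, Matrix.add_apply]
    congr 1
    rw [toEuclideanCLM_toLp]
    simp only [Matrix.mulVec, dotProduct, Fintype.sum_prod_type, Matrix.kroneckerMap_apply,
      Matrix.one_apply]
    rw [Matrix.mul_apply]
    simp [W]
  rw [e1]
  have e2 : (A * U * (W + η))ᵀ * K * (A * U * (W + η)) =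
      (W + η)ᵀ * diagonal d * (W + η) := by
    have : Uᵀ * (A * K * A) * U = diagonal d := by
      rw [hK]
      calc Uᵀ * (U * diagonal d * Uᵀ) * U = (Uᵀ * U) * diagonal d * (Uᵀ * U) := by
            simp only [Matrix.mul_assoc]
        _ = _ := by rw [hU, Matrix.one_mul, Matrix.mul_one]
    rw [← this, Matrix.transpose_mul, Matrix.transpose_mul, hAt]
    simp only [Matrix.mul_assoc]
  rw [e2, trace_transpose_mul_diagonal_mul, Finset.mul_sum]
  refine Finset.sum_congr rfl fun i _ => ?_
  rw [Matrix.add_apply]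
  simp only [W, Matrix.of_apply, mul_assoc]

end QuadraticForm

/-! ### One-dimensional integrals in the Laplace variable. -/

section InverseMomentIntegrals

theorem lintegral_exp_neg_mul_Ioi {F : ℝ} (hF : 0 ≤ F) :
    ∫⁻ t in Set.Ioi (0 : ℝ), ENNReal.ofReal (Real.exp (-(t * F))) = (ENNReal.ofReal F)⁻¹ := by
  rcases hF.eq_or_lt with rfl | hF
  -- For F = 0 both sides are infinite.
  · simp
  have e : ∀ t : ℝ, Real.exp (-(t * F)) = Real.exp (-F * t) := fun t => by
    congr 1; ring
  have hneg : -F < 0 := by linarith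
  simp only [e]
  rw [← ofReal_integral_eq_lintegral_ofReal (integrableOn_exp_mul_Ioi hneg 0)
    (Filter.Eventually.of_forall fun t => (Real.exp_pos _).le), integral_exp_mul_Ioi hneg 0,
    ← ENNReal.ofReal_inv_of_pos hF]
  congr 1
  field_simp
  simp

/-- The convergent case: 3 is the smallest integer power of (1 + 2tδ)^(-1/2) integrable at infinity.
An antiderivative is -δ⁻¹(1 + 2tδ)^(-1/2). -/
theorem lintegral_inv_sqrt_pow_three {δ : ℝ} (hδ : 0 < δ) :
    ∫⁻ t in Set.Ioi (0 : ℝ), ENNReal.ofReal ((√(1 + 2 * (t * δ)))⁻¹ ^ 3) = ENNReal.ofReal δ⁻¹ := by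
  have hpos : ∀ t : ℝ, 0 ≤ t → 0 < 1 + 2 * (t * δ) := fun t ht => by positivity
  have hderiv : ∀ t ∈ Set.Ici (0 : ℝ), HasDerivAt (fun t : ℝ => -(δ⁻¹ * (√(1 + 2 * (t * δ)))⁻¹))
      ((√(1 + 2 * (t * δ)))⁻¹ ^ 3) t := fun t ht => by
    have h1 : HasDerivAt (fun t : ℝ => 1 + 2 * (t * δ)) (2 * δ) t := by
      simpa using (((hasDerivAt_id t).mul_const δ).const_mul 2).const_add 1
    have hp := hpos t ht
    have h2 := (((h1.sqrt hp.ne').fun_inv (Real.sqrt_pos.mpr hp).ne').const_mul δ⁻¹).fun_neg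
    refine h2.congr_deriv ?_
    have : √(1 + 2 * (t * δ)) ≠ 0 := (Real.sqrt_pos.mpr hp).ne'
    field_simp
  have hlim : Filter.Tendsto (fun t : ℝ => -(δ⁻¹ * (√(1 + 2 * (t * δ)))⁻¹)) Filter.atTop
      (nhds 0) := by
    have h1 : Filter.Tendsto (fun t : ℝ => 1 + 2 * (t * δ)) Filter.atTop Filter.atTop :=
      Filter.tendsto_atTop_add_const_left _ _
        ((Filter.tendsto_id.atTop_mul_const hδ).const_mul_atTop two_pos)
    simpa using ((Real.tendsto_sqrt_atTop.comp h1).inv_tendsto_atTop.const_mul δ⁻¹).neg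
  have hnn : ∀ t ∈ Set.Ioi (0 : ℝ), 0 ≤ (√(1 + 2 * (t * δ)))⁻¹ ^ 3 := fun t _ => by positivity
  rw [← ofReal_integral_eq_lintegral_ofReal
    (integrableOn_Ioi_deriv_of_nonneg' hderiv hnn hlim)
    (Filter.Eventually.of_forall fun t => by positivity),
    integral_Ioi_of_hasDerivAt_of_nonneg' hderiv hnn hlim]
  simp

/-- The divergent case, power 2: for t > 1 the integrand dominates a multiple of 1/t. -/
theorem lintegral_const_mul_inv_linear_eq_top {c D : ℝ} (hc : 0 < c) (hD : 0 < D) :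
    ∫⁻ t in Set.Ioi (0 : ℝ), ENNReal.ofReal (c * (1 + 2 * (t * D))⁻¹) = ∞ := by
  by_contra hne
  have hint : IntegrableOn (fun t : ℝ => c * (1 + 2 * (t * D))⁻¹) (Set.Ioi 0) := by
    refine ⟨Measurable.aestronglyMeasurable (by fun_prop), ?_⟩
    rw [hasFiniteIntegral_iff_ofReal]
    · exact Ne.lt_top hne
    · filter_upwards [ae_restrict_mem measurableSet_Ioi] with t ht
      have ht : 0 < t := ht
      positivity
  refine not_integrableOn_Ioi_inv (a := (1 : ℝ)) ?_
  have h1 : IntegrableOn (fun t : ℝ => ((1 + 2 * D) / c) * (c * (1 + 2 * (t * D))⁻¹))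
      (Set.Ioi 1) :=
    (hint.mono_set (Set.Ioi_subset_Ioi zero_le_one)).const_mul _
  refine h1.mono' (Measurable.aestronglyMeasurable (by fun_prop)) ?_
  filter_upwards [ae_restrict_mem measurableSet_Ioi] with t ht
  have ht : 1 < t := ht
  rw [Real.norm_of_nonneg (by positivity)]
  have e : ((1 + 2 * D) / c) * (c * (1 + 2 * (t * D))⁻¹) = (1 + 2 * D) / (1 + 2 * (t * D)) := by
    field_simp
  rw [e, inv_eq_one_div, div_le_div_iff₀ (by positivity) (by positivity)]
  nlinarith

end InverseMomentIntegrals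

/-! ### Eigenvalues of A S⁺ A. -/

section Spectral

variable {p q k : ℕ}

theorem sum_sq_mul_le {l m n : Type*} [Fintype l] [Fintype m] [Fintype n]
    (N : Matrix m n ℝ) (W : Matrix n l ℝ) (b : l) :
    ∑ i, (N * W) i b ^ 2 ≤ (∑ i, ∑ j, N i j ^ 2) * ∑ j, W j b ^ 2 := by
  rw [Finset.sum_mul]
  refine Finset.sum_le_sum fun i _ => ?_
  rw [Matrix.mul_apply]
  exact Finset.sum_mul_sq_le_sq_mul_sq _ _ _

theorem transpose_mul_self_apply_self {m n : Type*} [Fintype m] (N : Matrix m n ℝ) (b : n) :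
    (Nᵀ * N) b b = ∑ i, N i b ^ 2 := by
  rw [Matrix.mul_apply]
  exact Finset.sum_congr rfl fun i _ => by rw [Matrix.transpose_apply, sq]

theorem rank_moorePenrose {m n : Type*} [Fintype m] [Fintype n]
    (Y : Matrix m n ℝ) : (moorePenrose Y).rank = Y.rank := by
  have h := moorePenrose_spec Y
  apply le_antisymm
  · conv_lhs => rw [← h.self_mul_mul]
    exact (Matrix.rank_mul_le_left _ _).trans (Matrix.rank_mul_le_right _ _)
  · conv_lhs => rw [← h.mul_mul_self]
    exact (Matrix.rank_mul_le_left _ _).trans (Matrix.rank_mul_le_right _ _)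

/-- For the lower bound, let w be the i-th column of W = S⁺ A U = A⁻¹ U diag(d). Then S⁺SS⁺ = S⁺
gives ‖Yw‖² = d_i, while ‖w‖² ≤ ‖A⁻¹‖² d_i² in Frobenius norm; hence d_i ≤ ‖Y‖²‖A⁻¹‖² d_i², and a
nonzero d_i can be cancelled. -/
theorem exists_spectral_conj_moorePenrose {A : Matrix (Fin p) (Fin p) ℝ} (hAt : Aᵀ = A)
    (hAd : IsUnit A.det) (Y : Matrix (Fin k) (Fin p) ℝ) :
    ∃ (U : Matrix (Fin p) (Fin p) ℝ) (d : Fin p → ℝ), Uᵀ * U = 1 ∧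
      A * moorePenrose (Yᵀ * Y) * A = U * diagonal d * Uᵀ ∧ (∀ i, 0 ≤ d i) ∧
      (Finset.univ.filter fun i => d i ≠ 0).card = (Yᵀ * Y).rank ∧
      ∀ i, d i ≠ 0 → 1 ≤ (∑ a, ∑ b, Y a b ^ 2) * (∑ a, ∑ b, A⁻¹ a b ^ 2) * d i := by
  have h := moorePenrose_spec (Yᵀ * Y)
  have hB := moorePenrose_transpose_mul_self Y
  set G := moorePenrose (Yᵀ * Y)
  set B := moorePenrose Y
  have hGt : Gᵀ = G := by rw [hB, Matrix.transpose_mul, Matrix.transpose_transpose]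
  have hM : (A * G * A).IsHermitian := by
    rw [Matrix.IsHermitian, Matrix.conjTranspose_eq_transpose_of_trivial, Matrix.transpose_mul,
      Matrix.transpose_mul, hAt, hGt, Matrix.mul_assoc]
  obtain ⟨U, d, hU, hs⟩ := hM.exists_orthogonal_diagonal
  have hU' : U * Uᵀ = 1 := mul_eq_one_comm.mp hU
  have hdiag : diagonal d = Uᵀ * (A * G * A) * U := by
    rw [hs]
    calc diagonal d = (Uᵀ * U) * diagonal d * (Uᵀ * U) := by
          rw [hU, Matrix.one_mul, Matrix.mul_one]
      _ = _ := by simp only [Matrix.mul_assoc]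
  have hd0 : ∀ i, 0 ≤ d i := fun i => by
    have e : diagonal d = (Bᵀ * A * U)ᵀ * (Bᵀ * A * U) := by
      rw [hdiag, hB, Matrix.transpose_mul, Matrix.transpose_mul, hAt, Matrix.transpose_transpose]
      simp only [Matrix.mul_assoc]
    have := congrFun (congrFun e i) i
    rw [Matrix.diagonal_apply_eq, transpose_mul_self_apply_self] at this
    rw [this]
    exact Finset.sum_nonneg fun _ _ => sq_nonneg _
  have hUd : IsUnit U.det := by
    refine isUnit_iff_ne_zero.mpr fun h0 => ?_
    have := congrArg Matrix.det hU
    rw [Matrix.det_mul, h0, mul_zero, Matrix.det_one] at this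
    exact zero_ne_one this
  refine ⟨U, d, hU, hs, hd0, ?_, fun i hi => ?_⟩
  · have h1 : (diagonal d).rank = (Yᵀ * Y).rank := by
      rw [hdiag, Matrix.rank_mul_eq_left_of_isUnit_det _ _ hUd,
        Matrix.rank_mul_eq_right_of_isUnit_det _ _ (by rwa [Matrix.det_transpose]),
        Matrix.rank_mul_eq_left_of_isUnit_det _ _ hAd,
        Matrix.rank_mul_eq_right_of_isUnit_det _ _ hAd, rank_moorePenrose]
    rw [← h1, Matrix.rank_diagonal, Fintype.card_subtype]
  · let W := G * A * U
    have hW1 : W = A⁻¹ * (U * diagonal d) := by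
      have e : A * W = U * diagonal d := by
        calc A * W = A * G * A * U := by simp only [W, Matrix.mul_assoc]
          _ = U * diagonal d * (Uᵀ * U) := by rw [hs]; simp only [Matrix.mul_assoc]
          _ = _ := by rw [hU, Matrix.mul_one]
      rw [← e, Matrix.nonsing_inv_mul_cancel_left _ _ hAd]
    have hW2 : (Y * W)ᵀ * (Y * W) = diagonal d := by
      have e : (Y * W)ᵀ * (Y * W) = Uᵀ * (A * (G * (Yᵀ * Y) * G) * A) * U := by
        simp only [W, Matrix.transpose_mul, hAt, hGt, Matrix.mul_assoc]
      rw [e, h.self_mul_mul, hdiag]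
    have h1 : d i = ∑ a, (Y * W) a i ^ 2 := by
      rw [← transpose_mul_self_apply_self, hW2, Matrix.diagonal_apply_eq]
    have h2 := sum_sq_mul_le Y W i
    have h3 := sum_sq_mul_le A⁻¹ (U * diagonal d) i
    rw [← hW1] at h3
    have h4 : ∑ j, (U * diagonal d) j i ^ 2 = d i ^ 2 := by
      have h5 : ∑ j, U j i ^ 2 = 1 := by
        rw [← transpose_mul_self_apply_self, hU, Matrix.one_apply_eq]
      simp only [Matrix.mul_diagonal, mul_pow]
      rw [← Finset.sum_mul, h5, one_mul]
    rw [h4] at h3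
    rw [← h1] at h2
    have hdi : 0 < d i := (hd0 i).lt_of_ne' hi
    have hY0 : 0 ≤ ∑ a, ∑ b, Y a b ^ 2 := by positivity
    have h6 : d i ≤ (∑ a, ∑ b, Y a b ^ 2) * (∑ a, ∑ b, A⁻¹ a b ^ 2) * d i * d i := by
      calc d i ≤ _ := h2
        _ ≤ (∑ a, ∑ b, Y a b ^ 2) * ((∑ a, ∑ b, A⁻¹ a b ^ 2) * d i ^ 2) :=
            mul_le_mul_of_nonneg_left h3 hY0
        _ = _ := by ring
    exact le_of_mul_le_mul_right (by linarith) hdi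

end Spectral

/-! ### The expectation of 1/F for fixed Y. -/

section InverseMoments

variable {p q k : ℕ} {Sig : Matrix (Fin p) (Fin p) ℝ}

theorem lintegral_inv_statF_eq_lintegral_laplace {μ : Measure (EuclideanSpace ℝ (Fin p × Fin q))}
    [SFinite μ] (Y : Matrix (Fin k) (Fin p) ℝ) :
    ∫⁻ x, (ENNReal.ofReal (statF (matOf x) (Yᵀ * Y)))⁻¹ ∂μ =
      ∫⁻ t in Set.Ioi (0 : ℝ), ∫⁻ x, ENNReal.ofReal
        (Real.exp (-(t * ((matOf x)ᵀ * moorePenrose (Yᵀ * Y) * matOf x).trace))) ∂μ := by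
  have hF : Measurable fun x : EuclideanSpace ℝ (Fin p × Fin q) =>
      ((matOf x)ᵀ * moorePenrose (Yᵀ * Y) * matOf x).trace :=
    ((measurableEntries_matOf.transpose.mul (measurableEntries_const _)).mul
      measurableEntries_matOf).trace
  rw [← lintegral_lintegral_swap
    (measurable_snd.mul (hF.comp measurable_fst)).neg.exp.ennreal_ofReal.aemeasurable]
  refine lintegral_congr fun x => ?_
  rw [← lintegral_exp_neg_mul_Ioi (statF_nonneg (matOf x) Y), statF]

theorem prod_ite_pow {d : Fin p → ℝ} (s : ℝ) :
    ∏ i : Fin p × Fin q, (if d i.1 ≠ 0 then s else 1) =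
      s ^ (q * (Finset.univ.filter fun i => d i ≠ 0).card) := by
  have e : ∀ k : Fin p, ∏ l : Fin q, (if d (k, l).1 ≠ 0 then s else 1) =
      (if d k ≠ 0 then s else 1) ^ q := fun k => by by_cases h : d k = 0 <;> simp [h]
  rw [Fintype.prod_prod_type, Finset.prod_congr rfl fun k _ => e k, Finset.prod_pow, Finset.prod_ite, Finset.prod_const_one, mul_one, Finset.prod_const,
    ← pow_mul, mul_comm]

/-- Each factor with d ≠ 0 is at most (1 + 2t/g)^(-1/2), where g is the right-hand side, and the
remaining factors are at most 1. The bound must be explicit in Y because it is integrated over Y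
afterwards. -/
theorem lintegral_inv_statF_le (hSig : Sig.PosDef) (θ : Matrix (Fin p) (Fin q) ℝ)
    (Y : Matrix (Fin k) (Fin p) ℝ) (hr : 2 < q * (Yᵀ * Y).rank) :
    ∫⁻ x, (ENNReal.ofReal (statF (matOf x) (Yᵀ * Y)))⁻¹
        ∂(multivariateGaussian (vecEntries θ) (Sig ⊗ₖ (1 : Matrix (Fin q) (Fin q) ℝ))) ≤
      ENNReal.ofReal ((∑ a, ∑ b, Y a b ^ 2) * (∑ a, ∑ b, (matSqrt Sig)⁻¹ a b ^ 2)) := by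
  have hA := matSqrt_posDef hSig
  have hAt : (matSqrt Sig)ᵀ = matSqrt Sig := by
    rw [← Matrix.conjTranspose_eq_transpose_of_trivial]; exact hA.isHermitian
  obtain ⟨U, d, hU, hs, hd, hcard, hlow⟩ :=
    exists_spectral_conj_moorePenrose hAt hA.det_pos.ne'.isUnit Y
  obtain ⟨η, hη⟩ := exists_laplace_quadraticForm hSig θ hU hs hd
  rw [lintegral_inv_statF_eq_lintegral_laplace]
  set g := (∑ a, ∑ b, Y a b ^ 2) * (∑ a, ∑ b, (matSqrt Sig)⁻¹ a b ^ 2)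
  have hg : 0 < g := by
    have hpos : 0 < (Finset.univ.filter fun i => d i ≠ 0).card := by
      rw [hcard]; exact Nat.pos_of_ne_zero fun h0 => by simp [h0] at hr
    obtain ⟨i, hi⟩ := Finset.card_pos.mp hpos
    have hi := (Finset.mem_filter.mp hi).2
    have h0 : 0 ≤ g := by positivity
    refine h0.lt_of_ne' fun h => ?_
    have := hlow i hi
    rw [h] at this
    linarith
  calc _ ≤ ∫⁻ t in Set.Ioi (0 : ℝ), ENNReal.ofReal ((√(1 + 2 * (t * g⁻¹)))⁻¹ ^ 3) := by
        refine setLIntegral_mono' measurableSet_Ioi fun t ht => ?_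
        have ht : 0 < t := ht
        rw [hη t ht.le]
        refine ENNReal.ofReal_le_ofReal ?_
        set s := (√(1 + 2 * (t * g⁻¹)))⁻¹
        have hs0 : 0 ≤ s := by positivity
        have hs1 : s ≤ 1 := by
          refine inv_le_one_of_one_le₀ (Real.one_le_sqrt.mpr ?_)
          have : 0 ≤ t * g⁻¹ := by positivity
          linarith
        calc _ ≤ ∏ i : Fin p × Fin q, (if d i.1 ≠ 0 then s else 1) := by
              refine Finset.prod_le_prod (fun i _ => by positivity) fun i _ => ?_
              have htd : 0 ≤ t * d i.1 := mul_nonneg ht.le (hd i.1)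
              have hexp : Real.exp (-(t * d i.1) * η i ^ 2 / (1 + 2 * (t * d i.1))) ≤ 1 := by
                rw [Real.exp_le_one_iff]
                refine div_nonpos_of_nonpos_of_nonneg ?_ (by positivity)
                nlinarith [mul_nonneg htd (sq_nonneg (η i))]
              refine (mul_le_of_le_one_right (by positivity) hexp).trans ?_
              split_ifs with hi
              · have hle : g⁻¹ ≤ d i.1 := by
                  rw [inv_le_iff_one_le_mul₀' hg]
                  exact hlow _ hi
                simp only [s]
                gcongr
              · refine inv_le_one_of_one_le₀ (Real.one_le_sqrt.mpr ?_)
                linarith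
          _ = s ^ (q * (Yᵀ * Y).rank) := by rw [prod_ite_pow, hcard]
          -- Here `2 < q * rank` is used in the form 3 ≤ q * rank.
          _ ≤ s ^ 3 := pow_le_pow_of_le_one hs0 hs1 hr
    _ = ENNReal.ofReal g := by
        rw [lintegral_inv_sqrt_pow_three (inv_pos.mpr hg), inv_inv]

theorem lintegral_inv_statF_eq_top (hSig : Sig.PosDef) (θ : Matrix (Fin p) (Fin q) ℝ)
    (Y : Matrix (Fin k) (Fin p) ℝ) (hr : q * (Yᵀ * Y).rank ≤ 2) :
    ∫⁻ x, (ENNReal.ofReal (statF (matOf x) (Yᵀ * Y)))⁻¹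
        ∂(multivariateGaussian (vecEntries θ) (Sig ⊗ₖ (1 : Matrix (Fin q) (Fin q) ℝ))) = ∞ := by
  have hA := matSqrt_posDef hSig
  have hAt : (matSqrt Sig)ᵀ = matSqrt Sig := by
    rw [← Matrix.conjTranspose_eq_transpose_of_trivial]; exact hA.isHermitian
  obtain ⟨U, d, hU, hs, hd, hcard, -⟩ :=
    exists_spectral_conj_moorePenrose hAt hA.det_pos.ne'.isUnit Y
  obtain ⟨η, hη⟩ := exists_laplace_quadraticForm hSig θ hU hs hd
  rw [lintegral_inv_statF_eq_lintegral_laplace]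
  -- An upper bound for all eigenvalues; adding 1 keeps it positive when every d vanishes.
  set D := ∑ i, d i + 1
  have hdD : ∀ i, d i ≤ D := fun i =>
    (Finset.single_le_sum (fun j _ => hd j) (Finset.mem_univ i)).trans (by simp [D])
  have hD : 0 < D := by
    have := Finset.sum_nonneg fun i (_ : i ∈ Finset.univ) => hd i
    positivity
  -- A lower bound for the exponential factors, uniform in t, since td/(1 + 2td) ≤ 1/2.
  set c := ∏ i : Fin p × Fin q, Real.exp (-η i ^ 2 / 2)
  have hc : 0 < c := Finset.prod_pos fun i _ => Real.exp_pos _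
  rw [← top_le_iff, ← lintegral_const_mul_inv_linear_eq_top hc hD]
  refine setLIntegral_mono' measurableSet_Ioi fun t ht => ?_
  have ht : 0 < t := ht
  rw [hη t ht.le]
  refine ENNReal.ofReal_le_ofReal ?_
  have hDp : 0 < 1 + 2 * (t * D) := by positivity
  set s := (√(1 + 2 * (t * D)))⁻¹ with hsdef
  have hs0 : 0 ≤ s := by positivity
  have hs1 : s ≤ 1 := by
    refine inv_le_one_of_one_le₀ (Real.one_le_sqrt.mpr ?_)
    have : 0 ≤ t * D := by positivity
    linarith
  calc c * (1 + 2 * (t * D))⁻¹ = s ^ 2 * c := by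
        rw [hsdef, inv_pow, Real.sq_sqrt hDp.le, mul_comm]
    _ ≤ s ^ (q * (Yᵀ * Y).rank) * c :=
        mul_le_mul_of_nonneg_right (pow_le_pow_of_le_one hs0 hs1 hr) hc.le
    _ = ∏ i : Fin p × Fin q, ((if d i.1 ≠ 0 then s else 1) * Real.exp (-η i ^ 2 / 2)) := by
        rw [Finset.prod_mul_distrib, prod_ite_pow, hcard]
    _ ≤ _ := by
        refine Finset.prod_le_prod (fun i _ => ?_) fun i _ => ?_
        · split_ifs <;> positivity
        · have htd : 0 ≤ t * d i.1 := mul_nonneg ht.le (hd i.1)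
          refine mul_le_mul ?_ ?_ (Real.exp_pos _).le (by positivity)
          · split_ifs with hi
            · have hle := hdD i.1
              simp only [s]
              gcongr
            · rw [not_not] at hi
              simp [hi]
          · rw [Real.exp_le_exp, div_le_div_iff₀ two_pos (by positivity)]
            nlinarith [sq_nonneg (η i), mul_nonneg htd (sq_nonneg (η i))]

end InverseMoments

/-! ### Almost sure positivity of F, disintegration over S, and the main theorem. -/

section Assembly

variable {p q k : ℕ}

/-- F = ‖BᵀX‖² vanishes only if BᵀX = 0. If (Bᵀ)_ij ≠ 0, moving X along E_jl changes the entry (i,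
l) of BᵀX with nonzero slope, so each such line meets the zero set at most once. -/
theorem ae_statF_ne_zero {Sig : Matrix (Fin p) (Fin p) ℝ} (hSig : Sig.PosDef) (hq : 1 ≤ q)
    (θ : Matrix (Fin p) (Fin q) ℝ) {Y : Matrix (Fin k) (Fin p) ℝ} (hY : Y ≠ 0) :
    ∀ᵐ x ∂(multivariateGaussian (vecEntries θ) (Sig ⊗ₖ (1 : Matrix (Fin q) (Fin q) ℝ))),
      statF (matOf x) (Yᵀ * Y) ≠ 0 := by
  have hm : Measurable fun x : EuclideanSpace ℝ (Fin p × Fin q) => statF (matOf x) (Yᵀ * Y) :=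
    ((measurableEntries_matOf.transpose.mul (measurableEntries_const _)).mul
      measurableEntries_matOf).trace
  have hB : (moorePenrose Y)ᵀ ≠ 0 := fun h0 => hY (by
    rw [← (moorePenrose_spec Y).mul_mul_self, Matrix.transpose_eq_zero.mp h0]
    simp)
  obtain ⟨i, j, hij⟩ : ∃ i j, (moorePenrose Y)ᵀ i j ≠ 0 := by
    by_contra! h
    exact hB (Matrix.ext h)
  let l : Fin q := ⟨0, hq⟩
  refine ae_iff.mpr ?_
  simp only [ne_eq, not_not]
  refine multivariateGaussian_null_of_countable_lines (hSig.kronecker Matrix.PosDef.one)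
    (hm (measurableSet_singleton 0)) (vecEntries (Matrix.single j l 1)) fun x => ?_
  refine Set.Subsingleton.countable fun s hs t ht => ?_
  have key : ∀ u : ℝ, statF (matOf (x + u • vecEntries (Matrix.single j l 1))) (Yᵀ * Y) = 0 →
      ((moorePenrose Y)ᵀ * matOf x) i l + u * (moorePenrose Y)ᵀ i j = 0 := fun u hu => by
    rw [statF, statF_transpose_mul_self_eq_trace_gram,
      ← Matrix.conjTranspose_eq_transpose_of_trivial,
      Matrix.trace_conjTranspose_mul_self_eq_zero_iff] at hu
    have e : matOf (x + u • vecEntries (Matrix.single j l (1 : ℝ))) =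
        matOf x + u • Matrix.single j l (1 : ℝ) := rfl
    rw [e, Matrix.mul_add, Matrix.mul_smul] at hu
    simpa using congrFun (congrFun hu i) l
  have := (key s hs).trans (key t ht).symm
  exact mul_right_cancel₀ hij (add_left_cancel this)

/-- The symmetric part of the matrix with the given vector of entries. -/
noncomputable def symMatOf (s : EuclideanSpace ℝ (Fin p × Fin p)) : Matrix (Fin p) (Fin p) ℝ :=
  Matrix.of fun i j => (matOf s i j + matOf s j i) / 2

theorem symMatOf_isHermitian (s : EuclideanSpace ℝ (Fin p × Fin p)) :
    (symMatOf s).IsHermitian := by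
  ext i j
  simp [symMatOf, add_comm]

theorem measurableEntries_symMatOf :
    MeasurableEntries fun s : EuclideanSpace ℝ (Fin p × Fin p) => symMatOf s := fun i j =>
  ((measurableEntries_matOf i j).add (measurableEntries_matOf j i)).div_const 2

theorem symMatOf_vecEntries {S : Matrix (Fin p) (Fin p) ℝ} (hS : Sᵀ = S) :
    symMatOf (vecEntries S) = S := by
  ext i j
  have : S j i = S i j := congrFun (congrFun hS i) j
  simp [symMatOf, this]

theorem symMatOf_vecEntries_transpose_mul_self (Y : Matrix (Fin k) (Fin p) ℝ) :
    symMatOf (vecEntries (Yᵀ * Y)) = Yᵀ * Y :=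
  symMatOf_vecEntries (by rw [Matrix.transpose_mul, Matrix.transpose_transpose])

theorem measurable_vecEntries_gram :
    Measurable fun y : EuclideanSpace ℝ (Fin k × Fin p) =>
      vecEntries ((matOf y)ᵀ * matOf y) := by
  refine (MeasurableEquiv.toLp 2 _).measurable.comp (measurable_pi_lambda _ fun ij => ?_)
  exact (measurableEntries_matOf.transpose.mul measurableEntries_matOf) ij.1 ij.2

/-- Integrals of functions of independent `X` and `S = Yᵀ Y` as iterated integrals. -/
theorem lintegral_comp_of_indepFun {Ω : Type*} [MeasurableSpace Ω] {P : Measure Ω}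
    [IsProbabilityMeasure P] {X : Ω → Matrix (Fin p) (Fin q) ℝ} {Y : Ω → Matrix (Fin k) (Fin p) ℝ}
    {μ : Measure (EuclideanSpace ℝ (Fin p × Fin q))}
    {ν : Measure (EuclideanSpace ℝ (Fin k × Fin p))}
    (hX : HasLaw (fun ω => vecEntries (X ω)) μ P) (hY : HasLaw (fun ω => vecEntries (Y ω)) ν P)
    (hXS : IndepFun (fun ω => vecEntries (X ω)) (fun ω => vecEntries ((Y ω)ᵀ * Y ω)) P)
    {f : Matrix (Fin p) (Fin q) ℝ → Matrix (Fin p) (Fin p) ℝ → ℝ≥0∞}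
    (hf : Measurable fun z : EuclideanSpace ℝ (Fin p × Fin q) × EuclideanSpace ℝ (Fin p × Fin p) =>
      f (matOf z.1) (symMatOf z.2)) :
    ∫⁻ ω, f (X ω) ((Y ω)ᵀ * Y ω) ∂P =
      ∫⁻ y, ∫⁻ x, f (matOf x) ((matOf y)ᵀ * matOf y) ∂μ ∂ν := by
  have hSm : AEMeasurable (fun ω => vecEntries ((Y ω)ᵀ * Y ω)) P :=
    measurable_vecEntries_gram.comp_aemeasurable hY.aemeasurable
  have hSlaw : P.map (fun ω => vecEntries ((Y ω)ᵀ * Y ω)) =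
      ν.map fun y => vecEntries ((matOf y)ᵀ * matOf y) := by
    rw [← hY.map_eq, AEMeasurable.map_map_of_aemeasurable
      measurable_vecEntries_gram.aemeasurable hY.aemeasurable]
    rfl
  have hprod := (indepFun_iff_map_prod_eq_prod_map_map hX.aemeasurable hSm).mp hXS
  have : IsProbabilityMeasure μ := hX.isProbabilityMeasure_iff.mp inferInstance
  have : IsProbabilityMeasure ν := hY.isProbabilityMeasure_iff.mp inferInstance
  calc ∫⁻ ω, f (X ω) ((Y ω)ᵀ * Y ω) ∂P
      = ∫⁻ z, f (matOf z.1) (symMatOf z.2)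
          ∂(P.map fun ω => (vecEntries (X ω), vecEntries ((Y ω)ᵀ * Y ω))) := by
        rw [lintegral_map' hf.aemeasurable (hX.aemeasurable.prodMk hSm)]
        -- Symmetrising leaves Gram matrices unchanged; it serves to extend the integrand measurably
        -- to vectors that do not come from symmetric matrices.
        simp only [matOf_vecEntries, symMatOf_vecEntries_transpose_mul_self]
    _ = _ := by
        rw [hprod, hX.map_eq, hSlaw, lintegral_prod_symm _ hf.aemeasurable,
          lintegral_map hf.lintegral_prod_left' measurable_vecEntries_gram]
        simp only [symMatOf_vecEntries_transpose_mul_self]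

theorem smul_tildeY_mul {Sig : Matrix (Fin p) (Fin p) ℝ} (hSig : Sig.PosDef) (hq : 1 ≤ q)
    (Y : Matrix (Fin k) (Fin p) ℝ) : (√(q : ℝ))⁻¹ • (tildeY q Sig Y * matSqrt Sig) = Y := by
  have hc : √(q : ℝ) ≠ 0 := by positivity
  rw [tildeY, Matrix.smul_mul, inv_smul_smul₀ hc, Matrix.nonsing_inv_mul_cancel_right _ _
    (matSqrt_posDef hSig).det_pos.ne'.isUnit]

theorem rank_transpose_mul_self_eq_min {Y : Matrix (Fin k) (Fin p) ℝ}
    (h : (p ≤ k ∧ (Yᵀ * Y).det ≠ 0) ∨ (k ≤ p ∧ (Y * Yᵀ).det ≠ 0)) :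
    (Yᵀ * Y).rank = min p k := by
  rcases h with ⟨h1, h2⟩ | ⟨h1, h2⟩
  · rw [rank_transpose_mul_self_of_det_ne_zero h2, Fintype.card_fin, min_eq_left h1]
  · rw [rank_transpose_mul_self_of_det_ne_zero' h2, Fintype.card_fin, min_eq_right h1]

end Assembly

theorem mainTheorem4
    {Ω : Type*} [MeasurableSpace Ω] (P : Measure Ω) [IsProbabilityMeasure P]
    (p q n : ℕ) (hp : 1 ≤ p) (hq : 1 ≤ q) (hn : 1 ≤ n)
    (θ : Matrix (Fin p) (Fin q) ℝ)
    (Sig : Matrix (Fin p) (Fin p) ℝ) (hSig : Sig.PosDef)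
    (X : Ω → Matrix (Fin p) (Fin q) ℝ)
    (Y : Ω → Matrix (Fin (n * q)) (Fin p) ℝ)
    (S : Ω → Matrix (Fin p) (Fin p) ℝ) (hS : ∀ ω, S ω = (Y ω)ᵀ * Y ω)
    (hX : IsMatrixNormal X θ Sig (1 : Matrix (Fin q) (Fin q) ℝ) P)
    (hY : IsMatrixNormal Y 0 (1 : Matrix (Fin (n * q)) (Fin (n * q)) ℝ) ((q : ℝ)⁻¹ • Sig) P)
    (hXS : IndepFun (fun ω => vecEntries (X ω)) (fun ω => vecEntries (S ω)) P)
    (r : ℝ → ℝ) (c₁ c₂ cstar : ℝ)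
    (hr : Differentiable ℝ r)
    (hr_mem : ∀ t, r t ∈ Set.Icc 0 c₁)
    (hr_deriv : ∀ t, |deriv r t| ≤ c₂)
    (hcstar : 0 < cstar)
    (hr_low : ∀ t, 0 ≤ t → r t ∈ Set.Icc cstar c₁)
    (hpnq : 1 < |(p : ℤ) - (n : ℤ) * (q : ℤ)|) :
    (∀ᵐ ω ∂P, HasPartials (fieldYH r Sig (X ω)) (tildeY q Sig (Y ω))) ∧
    AEMeasurable (fun ω => matDiv (fieldYH r Sig (X ω)) (tildeY q Sig (Y ω))) P ∧
    ((∫⁻ ω, ENNReal.ofReal |matDiv (fieldYH r Sig (X ω)) (tildeY q Sig (Y ω))| ∂P < ∞) ↔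
      P {ω | 2 < q * (S ω).rank} = 1) := by
  obtain rfl : S = fun ω => (Y ω)ᵀ * Y ω := funext hS
  beta_reduce at hXS ⊢
  have hCpd : ((1 : Matrix (Fin (n * q)) (Fin (n * q)) ℝ) ⊗ₖ ((q : ℝ)⁻¹ • Sig)).PosDef :=
    Matrix.PosDef.one.kronecker (hSig.smul (by positivity))
  rw [IsMatrixNormal] at hX hY
  have hYfull := multivariateGaussian_ae_full_rank (μ := vecEntries 0) hCpd
  have hfull : ∀ᵐ ω ∂P, (p ≤ n * q ∧ ((Y ω)ᵀ * Y ω).det ≠ 0) ∨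
      (n * q ≤ p ∧ (Y ω * (Y ω)ᵀ).det ≠ 0) := by
    rw [← hY.map_eq] at hYfull
    exact ae_of_ae_map hY.aemeasurable hYfull
  have hmin : 1 ≤ min p (n * q) := le_min hp (Nat.mul_pos hn hq)
  have hFm : Measurable fun z : EuclideanSpace ℝ (Fin p × Fin q) ×
      EuclideanSpace ℝ (Fin p × Fin p) => statF (matOf z.1) (symMatOf z.2) :=
    MeasurableEntries.statF (fun i j => (measurableEntries_matOf i j).comp measurable_fst)
      (fun i j => (measurableEntries_symMatOf i j).comp measurable_snd)
      fun _ => symMatOf_isHermitian _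
  have hF0 : ∀ᵐ ω ∂P, statF (X ω) ((Y ω)ᵀ * Y ω) ≠ 0 := by
    have hmeas : Measurable fun z : EuclideanSpace ℝ (Fin p × Fin q) ×
        EuclideanSpace ℝ (Fin p × Fin p) =>
        Set.indicator {0} (1 : ℝ → ℝ≥0∞) (statF (matOf z.1) (symMatOf z.2)) :=
      (measurable_one.indicator (measurableSet_singleton 0)).comp hFm
    have h0 := lintegral_comp_of_indepFun hX hY hXS
      (f := fun x s => Set.indicator {0} (1 : ℝ → ℝ≥0∞) (statF x s)) hmeas
    have hz : ∫⁻ y, ∫⁻ x, Set.indicator {0} (1 : ℝ → ℝ≥0∞)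
        (statF (matOf x) ((matOf y)ᵀ * matOf y)) ∂(multivariateGaussian (vecEntries θ)
          (Sig ⊗ₖ (1 : Matrix (Fin q) (Fin q) ℝ))) ∂(multivariateGaussian (vecEntries 0)
          ((1 : Matrix (Fin (n * q)) (Fin (n * q)) ℝ) ⊗ₖ ((q : ℝ)⁻¹ • Sig))) = 0 := by
      refine lintegral_eq_zero_of_ae_eq_zero ?_
      filter_upwards [hYfull] with y hy
      refine lintegral_eq_zero_of_ae_eq_zero ?_
      have hy0 : matOf y ≠ 0 := fun h => by
        have := rank_transpose_mul_self_eq_min hy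
        rw [h, Matrix.mul_zero, Matrix.rank_zero] at this
        omega
      filter_upwards [ae_statF_ne_zero hSig hq θ hy0] with x hx
      simp [hx]
    rw [hz, lintegral_eq_zero_iff' ?_] at h0
    · filter_upwards [h0] with ω hω hc
      simp [hc] at hω
    · have hSm := measurable_vecEntries_gram.comp_aemeasurable hY.aemeasurable
      have := hmeas.comp_aemeasurable (hX.aemeasurable.prodMk hSm)
      simpa only [Function.comp_def, matOf_vecEntries,
        symMatOf_vecEntries_transpose_mul_self] using this
  set N : ℝ := |(p : ℝ) - (n * q : ℕ)| - 1 with hN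
  -- An integer of absolute value above 1 has absolute value at least 2.
  have hN1 : 1 ≤ N := by
    have h2 : (2 : ℤ) ≤ |(p : ℤ) - (n : ℤ) * (q : ℤ)| := hpnq
    have h3 : (2 : ℝ) ≤ |(p : ℝ) - (n : ℝ) * (q : ℝ)| := by exact_mod_cast h2
    rw [hN]
    push_cast
    linarith
  have hdiv : ∀ᵐ ω ∂P, HasPartials (fieldYH r Sig (X ω)) (tildeY q Sig (Y ω)) ∧
      matDiv (fieldYH r Sig (X ω)) (tildeY q Sig (Y ω)) =
        divergenceValue r N (X ω) ((Y ω)ᵀ * Y ω) := by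
    filter_upwards [hfull, hF0] with ω h1 h2
    exact fieldYH_divergence_eq_divergenceValue hr hSig hq (X ω) _
      (smul_tildeY_mul hSig hq (Y ω)) h1 h2
  have hSm := measurable_vecEntries_gram.comp_aemeasurable hY.aemeasurable
  have hDm : AEMeasurable (fun ω => matDiv (fieldYH r Sig (X ω)) (tildeY q Sig (Y ω))) P := by
    have hmeas : Measurable fun z : EuclideanSpace ℝ (Fin p × Fin q) ×
        EuclideanSpace ℝ (Fin p × Fin p) =>
        divergenceValue r N (matOf z.1) (symMatOf z.2) :=
      MeasurableEntries.divergenceValue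
        (fun i j => (measurableEntries_matOf i j).comp measurable_fst)
        (fun i j => (measurableEntries_symMatOf i j).comp measurable_snd)
        (fun _ => symMatOf_isHermitian _) hr N
    have := hmeas.comp_aemeasurable (hX.aemeasurable.prodMk hSm)
    simp only [Function.comp_def, matOf_vecEntries, symMatOf_vecEntries_transpose_mul_self] at this
    exact this.congr (hdiv.mono fun ω hω => hω.2.symm)
  refine ⟨hdiv.mono fun ω hω => hω.1, hDm, ?_⟩
  -- Two-sided comparison of |D| with 1/F; the additive constant is harmless because P is finite.
  have hb : ∀ᵐ ω ∂P,
      ENNReal.ofReal |matDiv (fieldYH r Sig (X ω)) (tildeY q Sig (Y ω))| ≤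
        ENNReal.ofReal ((N + 4) * c₁ ^ 2) * (ENNReal.ofReal (statF (X ω) ((Y ω)ᵀ * Y ω)))⁻¹
          + ENNReal.ofReal (4 * c₁ * c₂) ∧
      ENNReal.ofReal (cstar ^ 2) * (ENNReal.ofReal (statF (X ω) ((Y ω)ᵀ * Y ω)))⁻¹ ≤
        ENNReal.ofReal |matDiv (fieldYH r Sig (X ω)) (tildeY q Sig (Y ω))|
          + ENNReal.ofReal (4 * c₁ * c₂) := by
    filter_upwards [hdiv, hF0] with ω h1 h2
    have hpos := (statF_nonneg (X ω) (Y ω)).lt_of_ne' h2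
    obtain ⟨b1, b2⟩ := abs_divergenceValue_bounds hr_deriv hcstar hr_low hN1 (X ω) (Y ω) hpos
    rw [h1.2, ← ENNReal.ofReal_inv_of_pos hpos, ← ENNReal.ofReal_mul (by positivity),
      ← ENNReal.ofReal_mul (by positivity)]
    exact ⟨(ENNReal.ofReal_le_ofReal b1).trans ENNReal.ofReal_add_le,
      (ENNReal.ofReal_le_ofReal b2).trans ENNReal.ofReal_add_le⟩
  have hIeq := lintegral_comp_of_indepFun hX hY hXS
    (f := fun x s => (ENNReal.ofReal (statF x s))⁻¹) hFm.ennreal_ofReal.inv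
  have hfin : (∫⁻ ω, ENNReal.ofReal |matDiv (fieldYH r Sig (X ω)) (tildeY q Sig (Y ω))| ∂P < ∞) ↔
      ∫⁻ ω, (ENNReal.ofReal (statF (X ω) ((Y ω)ᵀ * Y ω)))⁻¹ ∂P < ∞ := by
    constructor
    · intro h
      have h1 := lintegral_mono_ae (hb.mono fun ω hω => hω.2)
      rw [lintegral_const_mul' _ _ ENNReal.ofReal_ne_top,
        lintegral_add_right _ measurable_const, lintegral_const, measure_univ, mul_one] at h1
      have h2 := h1.trans_lt (ENNReal.add_lt_top.mpr ⟨h, ENNReal.ofReal_lt_top⟩)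
      refine lt_top_iff_ne_top.mpr fun htop => ?_
      rw [htop, ENNReal.mul_top (by simpa using hcstar.ne')] at h2
      exact lt_irrefl _ h2
    · intro h
      have h1 := lintegral_mono_ae (hb.mono fun ω hω => hω.1)
      rw [lintegral_add_right _ measurable_const,
        lintegral_const_mul' _ _ ENNReal.ofReal_ne_top, lintegral_const, measure_univ,
        mul_one] at h1
      exact h1.trans_lt (ENNReal.add_lt_top.mpr
        ⟨ENNReal.mul_lt_top ENNReal.ofReal_lt_top h, ENNReal.ofReal_lt_top⟩)
  rw [hfin, hIeq]
  -- The rank is almost surely min(p, nq), so both sides of the equivalence are decided by this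
  -- deterministic inequality.
  by_cases hrk : 2 < q * min p (n * q)
  · refine iff_of_true ?_ ?_
    · calc _ ≤ ∫⁻ y, ENNReal.ofReal (∑ a, ∑ b, matOf y a b ^ 2) *
            ENNReal.ofReal (∑ a, ∑ b, (matSqrt Sig)⁻¹ a b ^ 2)
            ∂(multivariateGaussian (vecEntries 0)
              ((1 : Matrix (Fin (n * q)) (Fin (n * q)) ℝ) ⊗ₖ ((q : ℝ)⁻¹ • Sig))) := by
            refine lintegral_mono_ae ?_
            filter_upwards [hYfull] with y hy
            rw [← ENNReal.ofReal_mul (by positivity)]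
            exact lintegral_inv_statF_le hSig θ (matOf y)
              (by rwa [rank_transpose_mul_self_eq_min hy])
        _ < ∞ := by
            rw [lintegral_mul_const' _ _ ENNReal.ofReal_ne_top]
            exact ENNReal.mul_lt_top
              (multivariateGaussian_lintegral_sum_sq_lt_top hCpd.posSemidef) ENNReal.ofReal_lt_top
    · have : {ω | 2 < q * ((Y ω)ᵀ * Y ω).rank} =ᵐ[P] Set.univ := by
        rw [Filter.eventuallyEq_univ]
        filter_upwards [hfull] with ω hω
        rw [rank_transpose_mul_self_eq_min hω]
        exact hrk
      rw [measure_congr this, measure_univ]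
  · refine iff_of_false ?_ ?_
    · have e : ∀ᵐ y ∂(multivariateGaussian (vecEntries 0)
          ((1 : Matrix (Fin (n * q)) (Fin (n * q)) ℝ) ⊗ₖ ((q : ℝ)⁻¹ • Sig))),
          ∫⁻ x, (ENNReal.ofReal (statF (matOf x) ((matOf y)ᵀ * matOf y)))⁻¹
            ∂(multivariateGaussian (vecEntries θ)
              (Sig ⊗ₖ (1 : Matrix (Fin q) (Fin q) ℝ))) = ∞ := by
        filter_upwards [hYfull] with y hy
        exact lintegral_inv_statF_eq_top hSig θ (matOf y)
          (by rw [rank_transpose_mul_self_eq_min hy]; exact not_lt.mp hrk)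
      rw [lintegral_congr_ae e]
      simp
    · have : ({ω | 2 < q * ((Y ω)ᵀ * Y ω).rank} : Set Ω) =ᵐ[P] (∅ : Set Ω) := by
        rw [Filter.eventuallyEq_empty]
        filter_upwards [hfull] with ω hω
        rw [rank_transpose_mul_self_eq_min hω]
        exact hrk
      rw [measure_congr this, measure_empty]
      exact zero_ne_one
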